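/- Let $I$ be a dense linear order with a left endpoint $0$ and no right endpoint. A closed interval of $I$ is a set of the form $[i,j]$, $[i,+\infty)$ or $(-\infty,j]$ with $i,j\in I$. Let $\mathcal L=\{\cup,\cap,\bot,\mathfrak z,\min,\max,l,r\}$ be the signature with two binary function symbols $\cup,\cap$, two constants $\bot,\mathfrak z$ and four unary function symbols $\min,\max,l,r$, and let $\mathbf L(I)$ be the $\mathcal L$-structure whose universe is the set of all finite unions of closed intervals of $I$ and in which - $\cup,\cap$ are union and intersection, $\bot=\emptyset$ and $\mathfrak z=\{0\}$; - $\min(A)$ (respectively $\max(A)$) is the singleton containing the minimum (respectively maximum) of $A$ if it exists, and $\emptyset$ otherwise (so $\min(\emptyset)=\max(\emptyset)=\emptyset$, and $\max(A)=\emptyset$ if $A$ is unbounded); - $l(A)$ (respectively $r(A)$) is the set of left (respectively right) endpoints of $A$, that is, of all least (respectively greatest) elements of the maximal convex subsets of $A$ (an isolated point of $A$ is both a left and a right endpoint). Then $\mathbf L(I)$ is model-complete: every embedding between two models of the complete first-order theory of $\mathbf L(I)$ is elementary. Moreover, every $\mathcal L$-formula $\varphi(X_1,\dots,X_n)$ is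 equivalent over $\mathbf L(I)$ to an existential $\mathcal L$-formula $\psi(X_1,\dots,X_n)$, that is, one of the form $\exists Y_1\cdots\exists Y_m\,\theta$ with $\theta$ quantifier-free. -/

import Mathlib

open FirstOrder

universe u v w w'

namespace ClosedIntervals

/-! ### Finite unions of closed intervals -/

section Sets

variable {I : Type u} [LinearOrder I]

/-- A closed interval of a linear order: `[i, j]`, `[i, +∞)` or `(-∞, j]`. -/
def IsClosedInterval (S : Set I) : Prop :=
  (∃ i j, S = Set.Icc i j) ∨ (∃ i, S = Set.Ici i) ∨ (∃ j, S = Set.Iic j)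

/-- A set is a finite union of closed intervals. -/
def IsFCI (A : Set I) : Prop :=
  ∃ F : Set (Set I), F.Finite ∧ (∀ S ∈ F, IsClosedInterval S) ∧ A = ⋃₀ F

/-- The set of left endpoints of `A`: the points that are least in the convex component of `A`
containing them. -/
def leftEndpoints (A : Set I) : Set I :=
  {x | IsLeast (A.ordConnectedComponent x) x}

/-- The set of right endpoints of `A`: the points that are greatest in the convex component of `A`
containing them. -/
def rightEndpoints (A : Set I) : Set I :=
  {x | IsGreatest (A.ordConnectedComponent x) x}

/-- The singleton of the minimum of `A`; the empty set if `A` has no minimum. -/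
def minSet (A : Set I) : Set I := {x | IsLeast A x}

/-- The singleton of the maximum of `A`; the empty set if `A` has no maximum. -/
def maxSet (A : Set I) : Set I := {x | IsGreatest A x}

theorem IsClosedInterval.ordConnected {S : Set I} (h : IsClosedInterval S) : S.OrdConnected := by
  rcases h with ⟨i, j, rfl⟩ | ⟨i, rfl⟩ | ⟨j, rfl⟩
  · exact Set.ordConnected_Icc
  · exact Set.ordConnected_Ici
  · exact Set.ordConnected_Iic

theorem IsClosedInterval.inter {S T : Set I} (hS : IsClosedInterval S) (hT : IsClosedInterval T) :
    IsClosedInterval (S ∩ T) := by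
  rcases hS with ⟨i, j, rfl⟩ | ⟨i, rfl⟩ | ⟨j, rfl⟩ <;>
    rcases hT with ⟨k, l, rfl⟩ | ⟨k, rfl⟩ | ⟨l, rfl⟩
  · exact Or.inl ⟨i ⊔ k, j ⊓ l, Set.Icc_inter_Icc⟩
  · exact Or.inl ⟨i ⊔ k, j, by ext x; simp; tauto⟩
  · exact Or.inl ⟨i, j ⊓ l, by ext x; simp; tauto⟩
  · exact Or.inl ⟨i ⊔ k, l, by ext x; simp; tauto⟩
  · exact Or.inr (Or.inl ⟨i ⊔ k, Set.Ici_inter_Ici⟩)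
  · exact Or.inl ⟨i, l, Set.Ici_inter_Iic⟩
  · exact Or.inl ⟨k, j ⊓ l, by ext x; simp; tauto⟩
  · exact Or.inl ⟨k, j, by ext x; simp; tauto⟩
  · exact Or.inr (Or.inr ⟨j ⊓ l, Set.Iic_inter_Iic⟩)

theorem IsFCI.of_finite {A : Set I} (h : A.Finite) : IsFCI A := by
  refine ⟨(fun x => {x}) '' A, h.image _, ?_, ?_⟩
  · rintro _ ⟨x, _, rfl⟩
    exact Or.inl ⟨x, x, (Set.Icc_self x).symm⟩
  · simp

theorem IsFCI.union {A B : Set I} (hA : IsFCI A) (hB : IsFCI B) : IsFCI (A ∪ B) := by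
  obtain ⟨F, hF, hF', rfl⟩ := hA
  obtain ⟨G, hG, hG', rfl⟩ := hB
  refine ⟨F ∪ G, hF.union hG, ?_, Set.sUnion_union F G |>.symm⟩
  rintro S (hS | hS)
  · exact hF' S hS
  · exact hG' S hS

theorem IsFCI.inter {A B : Set I} (hA : IsFCI A) (hB : IsFCI B) : IsFCI (A ∩ B) := by
  obtain ⟨F, hF, hF', rfl⟩ := hA
  obtain ⟨G, hG, hG', rfl⟩ := hB
  refine ⟨Set.image2 (· ∩ ·) F G, hF.image2 _ hG, ?_, ?_⟩
  · rintro _ ⟨S, hS, T, hT, rfl⟩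
    exact (hF' S hS).inter (hG' T hT)
  · ext x
    simp only [Set.mem_inter_iff, Set.mem_sUnion, Set.mem_image2]
    constructor
    · rintro ⟨⟨S, hS, hx⟩, T, hT, hx'⟩
      exact ⟨S ∩ T, ⟨S, hS, T, hT, rfl⟩, hx, hx'⟩
    · rintro ⟨_, ⟨S, hS, T, hT, rfl⟩, hx, hx'⟩
      exact ⟨⟨S, hS, hx⟩, T, hT, hx'⟩

theorem minSet_subsingleton (A : Set I) : (minSet A).Subsingleton :=
  fun _ hx _ hy => IsLeast.unique hx hy

theorem maxSet_subsingleton (A : Set I) : (maxSet A).Subsingleton :=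
  fun _ hx _ hy => IsGreatest.unique hx hy

theorem mem_of_mem_ordConnectedComponent_self {A : Set I} {x : I}
    (h : x ∈ A.ordConnectedComponent x) : x ∈ A :=
  Set.self_mem_ordConnectedComponent.1 h

theorem leftEndpoints_finite {A : Set I} (hA : IsFCI A) : (leftEndpoints A).Finite := by
  obtain ⟨F, hF, hF', rfl⟩ := hA
  refine (hF.biUnion fun S _ => (minSet_subsingleton S).finite).subset fun x hx => ?_
  obtain ⟨S, hS, hxS⟩ := mem_of_mem_ordConnectedComponent_self hx.1
  refine Set.mem_biUnion hS ⟨hxS, fun y hy => hx.2 ?_⟩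
  exact ((hF' S hS).ordConnected.uIcc_subset hxS hy).trans (Set.subset_sUnion_of_mem hS)

theorem rightEndpoints_finite {A : Set I} (hA : IsFCI A) : (rightEndpoints A).Finite := by
  obtain ⟨F, hF, hF', rfl⟩ := hA
  refine (hF.biUnion fun S _ => (maxSet_subsingleton S).finite).subset fun x hx => ?_
  obtain ⟨S, hS, hxS⟩ := mem_of_mem_ordConnectedComponent_self hx.1
  refine Set.mem_biUnion hS ⟨hxS, fun y hy => hx.2 ?_⟩
  exact ((hF' S hS).ordConnected.uIcc_subset hxS hy).trans (Set.subset_sUnion_of_mem hS)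

end Sets

/-- The collection of finite unions of closed intervals of `I`. -/
def FCI (I : Type u) [LinearOrder I] : Type u := {A : Set I // IsFCI A}

/-! ### The signature and the structure -/

/-- The function symbols: `∪, ∩` (binary), `⊥, {0}` (constants), `min, max, l, r` (unary). -/
inductive LFun : ℕ → Type
  | union : LFun 2
  | inter : LFun 2
  | bot : LFun 0
  | zero : LFun 0
  | min : LFun 1
  | max : LFun 1
  | left : LFun 1
  | right : LFun 1

/-- The signature `{∪, ∩, ⊥, {0}, min, max, l, r}`, without relation symbols (besides equality). -/
def langL : FirstOrder.Language.{0, 0} := ⟨LFun, fun _ => Empty⟩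

/-- The structure `L(I)` on the finite unions of closed intervals of `I`, where `I` has a least
element `⊥`, the left endpoint `0`. -/
instance structureFCI (I : Type u) [LinearOrder I] [OrderBot I] : langL.Structure (FCI I) where
  funMap := fun {_} f =>
    match f with
    | LFun.union => fun x => ⟨(x 0).1 ∪ (x 1).1, (x 0).2.union (x 1).2⟩
    | LFun.inter => fun x => ⟨(x 0).1 ∩ (x 1).1, (x 0).2.inter (x 1).2⟩
    | LFun.bot => fun _ => ⟨∅, IsFCI.of_finite Set.finite_empty⟩
    | LFun.zero => fun _ => ⟨{⊥}, IsFCI.of_finite (Set.finite_singleton ⊥)⟩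
    | LFun.min => fun x => ⟨minSet (x 0).1, IsFCI.of_finite (minSet_subsingleton _).finite⟩
    | LFun.max => fun x => ⟨maxSet (x 0).1, IsFCI.of_finite (maxSet_subsingleton _).finite⟩
    | LFun.left => fun x => ⟨leftEndpoints (x 0).1, IsFCI.of_finite (leftEndpoints_finite (x 0).2)⟩
    | LFun.right =>
        fun x => ⟨rightEndpoints (x 0).1, IsFCI.of_finite (rightEndpoints_finite (x 0).2)⟩
  RelMap := fun {_} R => nomatch R

/-! ### Existential formulas and model-completeness -/

/-- Existential formulas: a quantifier-free formula preceded by a (possibly empty) block of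
existential quantifiers. -/
inductive IsExistential {L : FirstOrder.Language.{u, v}} {α : Type w} :
    ∀ {n : ℕ}, L.BoundedFormula α n → Prop
  | of_isQF {n : ℕ} {φ : L.BoundedFormula α n} (h : φ.IsQF) : IsExistential φ
  | ex {n : ℕ} {φ : L.BoundedFormula α (n + 1)} (h : IsExistential φ) : IsExistential φ.ex

/-- A theory is model-complete if every embedding between two of its models is elementary. -/
def IsModelComplete {L : FirstOrder.Language.{u, v}} (T : L.Theory) : Prop :=
  ∀ (M : Type w) (N : Type w') [L.Structure M] [L.Structure N], M ⊨ T → N ⊨ T →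
    ∀ (f : M ↪[L] N) (n : ℕ) (φ : L.Formula (Fin n)) (x : Fin n → M),
      φ.Realize (f ∘ x) ↔ φ.Realize x

end ClosedIntervals

/-!
A finite union of closed intervals is determined by the two finite sets of its left and right
endpoints, so a formula over `L(I)` is a formula of weak monadic second-order logic about finite
subsets of `I`. A tuple of finite subsets is read as a word: along any increasing list of points
that starts with the least element and contains all members, the letter at a point records which
sets of the tuple contain it. As in Büchi's theorem, every definable predicate is decided by a
regular language (`recognizable_formula`). Complements and intersections are clear. For an
existential quantifier (`Recognizable.exists`), a new finite set may use points not yet in the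
list; as `I` is dense and has no last point, any number of points can be inserted after each point
of the list, so the quantifier becomes the inverse image under a substitution of languages for
letters. Such an inverse image is regular by the Myhill–Nerode criterion
(`isRegular_substitution`), because it has finitely many left quotients. The terms of the signature
are treated by describing membership in their values with quantifiers over points.

Conversely, an accepting run of an automaton is coded by finitely many sets in `L(I)`
(`CodesRun`): one for each parity, state and letter, whose components are the closed intervals from
a point of the run with these data to the next point, or to `+∞`. The endpoint functions recover
the points of the run and the successor relation between them, so the requirements on such a family
are quantifier-free (`isQFDefinable_codesRun`). Hence a recognizable predicate is defined by the
existential formula that asserts the existence of a code of an accepting run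
(`exists_existential_formula`). Model-completeness follows, since embeddings preserve existential
formulas and each formula and its negation are equivalent to such formulas
(`isModelComplete_completeTheory`).
-/

namespace ClosedIntervals

/-! ### Regular languages -/

section Languages

variable {α β : Type*}

theorem isRegular_of_leftQuotient_factors {γ : Type*} [Finite γ] {L : Language α}
    (h : List α → γ) (g : γ → Language α) (H : ∀ u, L.leftQuotient u = g (h u)) : L.IsRegular := by
  refine .of_finite_range_leftQuotient ((Set.finite_range g).subset ?_)
  rintro _ ⟨u, rfl⟩
  exact ⟨h u, (H u).symm⟩

theorem isRegular_compl {L : Language α} (h : L.IsRegular) :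
    Language.IsRegular ({w | w ∉ L} : Language α) := by
  refine .of_finite_range_leftQuotient
    ((h.finite_range_leftQuotient.image fun K : Language α => ({w | w ∉ K} : Language α)).subset ?_)
  rintro _ ⟨u, rfl⟩
  exact ⟨_, ⟨u, rfl⟩, rfl⟩

theorem isRegular_and {L K : Language α} (hL : L.IsRegular) (hK : K.IsRegular) :
    Language.IsRegular ({w | w ∈ L ∧ w ∈ K} : Language α) := by
  refine .of_finite_range_leftQuotient ((Set.Finite.image2
    (fun A B : Language α => ({w | w ∈ A ∧ w ∈ B} : Language α))
    hL.finite_range_leftQuotient hK.finite_range_leftQuotient).subset ?_)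
  rintro _ ⟨u, rfl⟩
  exact ⟨_, ⟨u, rfl⟩, _, ⟨u, rfl⟩, rfl⟩

theorem isRegular_comap {L : Language β} (hL : L.IsRegular) (f : α → β) :
    Language.IsRegular ({w | w.map f ∈ L} : Language α) := by
  refine .of_finite_range_leftQuotient ((hL.finite_range_leftQuotient.image
    fun K : Language β => ({w | w.map f ∈ K} : Language α)).subset ?_)
  rintro _ ⟨u, rfl⟩
  refine ⟨_, ⟨u.map f, rfl⟩, ?_⟩
  ext w
  change u.map f ++ w.map f ∈ L ↔ (u ++ w).map f ∈ L
  rw [List.map_append]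

/-- The inverse image of a regular language under a substitution `σ` of languages for letters is
regular: the left quotient by `u` is determined by the set of left quotients of `L` by the words
in `σ(u)`. -/
theorem isRegular_substitution {L : Language β} (hL : L.IsRegular) (σ : α → Language β) :
    Language.IsRegular ({w | ∃ w' ∈ (w.map σ).prod, w' ∈ L} : Language α) := by
  refine .of_finite_range_leftQuotient ((hL.finite_range_leftQuotient.powerset.image
    fun S : Set (Language β) =>
      ({w | ∃ K ∈ S, ∃ w' ∈ (w.map σ).prod, w' ∈ K} : Language α)).subset ?_)
  rintro _ ⟨u, rfl⟩
  refine ⟨L.leftQuotient '' {x | x ∈ (u.map σ).prod}, Set.image_subset_range _ _, ?_⟩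
  ext w
  change (∃ K ∈ L.leftQuotient '' {x | x ∈ (u.map σ).prod}, ∃ w' ∈ (w.map σ).prod, w' ∈ K) ↔
    ∃ w' ∈ ((u ++ w).map σ).prod, w' ∈ L
  rw [List.map_append, List.prod_append]
  constructor
  · rintro ⟨_, ⟨x, hx, rfl⟩, w', hw', h⟩
    exact ⟨x ++ w', Language.append_mem_mul hx hw', h⟩
  · rintro ⟨w', hw', h⟩
    obtain ⟨x, hx, y, hy, rfl⟩ := Language.mem_mul.1 hw'
    exact ⟨_, ⟨x, hx, rfl⟩, y, hy, h⟩

theorem isRegular_forall_mem (p : α → Prop) :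
    Language.IsRegular ({w | ∀ a ∈ w, p a} : Language α) := by
  refine isRegular_of_leftQuotient_factors (fun u => ∀ a ∈ u, p a)
    (fun q => ({w | q ∧ ∀ a ∈ w, p a} : Language α)) fun u => ?_
  ext w
  change (∀ a ∈ u ++ w, p a) ↔ (∀ a ∈ u, p a) ∧ ∀ a ∈ w, p a
  simp only [List.mem_append, or_imp, forall_and]

theorem isRegular_pairwise (p q : α → Prop) :
    Language.IsRegular ({w | w.Pairwise fun a b => ¬ (p a ∧ q b)} : Language α) := by
  refine isRegular_of_leftQuotient_factors
    (fun u => (u.Pairwise (fun a b => ¬ (p a ∧ q b)), ∃ a ∈ u, p a))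
    (fun r => ({w | r.1 ∧ w.Pairwise (fun a b => ¬ (p a ∧ q b)) ∧ (r.2 → ∀ b ∈ w, ¬ q b)} :
      Language α)) fun u => ?_
  ext w
  change (u ++ w).Pairwise _ ↔ _ ∧ _ ∧ ((∃ a ∈ u, p a) → ∀ b ∈ w, ¬ q b)
  rw [List.pairwise_append]
  refine and_congr_right fun _ => and_congr_right fun _ => ?_
  constructor
  · rintro h ⟨a, ha, hp⟩ b hb hq
    exact h a ha b hb ⟨hp, hq⟩
  · rintro h a ha b hb ⟨hp, hq⟩
    exact h ⟨a, ha, hp⟩ b hb hq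

end Languages

/-! ### Tuples of finite sets as words -/

section Words

variable {I : Type u} [LinearOrder I] {V W : Type}

/-- The letter read at the point `x`: the set of indices of the members of the tuple `X` that
contain `x`. -/
def letter (X : V → Finset I) (x : I) : Set V := {v | x ∈ X v}

omit [LinearOrder I] in
@[simp] theorem mem_letter {X : V → Finset I} {x : I} {v : V} : v ∈ letter X x ↔ x ∈ X v := Iff.rfl

/-- A predicate on tuples of finite subsets of `I` is recognizable if a regular language decides it,
reading a tuple `X` along any finite increasing list of points that starts with the least element
and contains all members of `X`. The points of the list outside `X` contribute empty letters, and
the language may not depend on them. -/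
def Recognizable [OrderBot I] (P : (V → Finset I) → Prop) : Prop :=
  ∃ L : Language (Set V), L.IsRegular ∧ ∀ (X : V → Finset I) (p : List I),
    (⊥ :: p).Pairwise (· < ·) → (∀ v, ∀ x ∈ X v, x ∈ (⊥ :: p : List I)) →
      (P X ↔ (⊥ :: p).map (letter X) ∈ L)

/-- The substitution that adds a set to a tuple: a letter `a` is replaced by a letter that
restricts to `a`, followed by letters at new points, which restrict to the empty letter. -/
def blocks (a : Set V) : Language (Set (Option V)) :=
  {w | ∃ b u, w = b :: u ∧ some ⁻¹' b = a ∧ ∀ c ∈ u, some ⁻¹' c = (∅ : Set V)}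

theorem mem_prod_map_blocks_cons {a : Set V} {l : List (Set V)} {w : List (Set (Option V))} :
    w ∈ ((a :: l).map blocks).prod ↔ ∃ b u w', w = b :: (u ++ w') ∧ some ⁻¹' b = a ∧
      (∀ c ∈ u, some ⁻¹' c = (∅ : Set V)) ∧ w' ∈ (l.map blocks).prod := by
  rw [List.map_cons, List.prod_cons, Language.mem_mul]
  constructor
  · rintro ⟨_, ⟨b, u, rfl, hb, hu⟩, w', hw', rfl⟩
    exact ⟨b, u, w', rfl, hb, hu, hw'⟩
  · rintro ⟨b, u, w', rfl, hb, hu, hw'⟩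
    exact ⟨b :: u, ⟨b, u, rfl, hb, hu⟩, w', hw', rfl⟩

omit [LinearOrder I] in
/-- Enlarging a tuple by a set and the list `p` of points to `q` turns the word into a block
substitution of the old one, up to a prefix `u` of new points below all of `p`. The prefix is what
makes the induction work; it is empty when `p` and `q` start with the same point. -/
theorem sublist_word_mem_blocks {X : Option V → Finset I} {p q : List I} (h : p.Sublist q)
    (hq : q.Nodup) (hX : ∀ v, ∀ x ∈ X (some v), x ∈ q → x ∈ p) :
    ∃ u w, q.map (letter X) = u ++ w ∧ (∀ c ∈ u, some ⁻¹' c = (∅ : Set V)) ∧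
      w ∈ ((p.map (letter fun v => X (some v))).map blocks).prod := by
  induction h with
  | slnil => exact ⟨[], [], rfl, by simp, by simp⟩
  | @cons p q a h ih =>
    obtain ⟨haq, hq⟩ := List.nodup_cons.1 hq
    obtain ⟨u, w, h1, h2, h3⟩ := ih hq fun v x hx hxq => hX v x hx (List.mem_cons_of_mem _ hxq)
    refine ⟨letter X a :: u, w, by simp [h1], ?_, h3⟩
    simp only [List.mem_cons, forall_eq_or_imp]
    refine ⟨?_, h2⟩
    ext v
    simp only [Set.mem_preimage, mem_letter, Set.mem_empty_iff_false, iff_false]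
    exact fun hv => haq (h.subset (hX v a hv (by simp)))
  | @cons_cons p q a h ih =>
    obtain ⟨haq, hq⟩ := List.nodup_cons.1 hq
    obtain ⟨u, w, h1, h2, h3⟩ := ih hq fun v x hx hxq => by
      rcases List.mem_cons.1 (hX v x hx (List.mem_cons_of_mem _ hxq)) with rfl | h'
      · exact absurd hxq haq
      · exact h'
    refine ⟨[], _, rfl, by simp, ?_⟩
    rw [List.map_cons (l := p), mem_prod_map_blocks_cons]
    exact ⟨letter X a, u, w, by simp [h1], rfl, h2, h3⟩

/-- Any number of points outside a finite set fit between the head of an increasing list and the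
rest of the list; if the rest is empty, they exist because there is no greatest element. -/
theorem exists_insert_points [DenselyOrdered I] [NoMaxOrder I] {S : Set I} (hS : S.Finite)
    {x : I} {q : List I} (hq : (x :: q).Pairwise (· < ·)) (n : ℕ) :
    ∃ m : List I, m.length = n ∧ (x :: (m ++ q)).Pairwise (· < ·) ∧ ∀ z ∈ m, z ∉ S := by
  induction n with
  | zero => exact ⟨[], rfl, hq, by simp⟩
  | succ n ih =>
    obtain ⟨m, hm, hs, hmS⟩ := ih
    obtain ⟨z, hxz, hz, hzS⟩ : ∃ z, x < z ∧ (∀ y ∈ m ++ q, z < y) ∧ z ∉ S := by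
      generalize m ++ q = r at hs
      match r, hs with
      | [], _ =>
        obtain ⟨z, hz, hzS⟩ := ((Set.Ioi_infinite x).sdiff hS).nonempty
        exact ⟨z, hz, by simp, hzS⟩
      | y :: r, hs =>
        simp only [List.pairwise_cons, List.mem_cons, forall_eq_or_imp] at hs
        obtain ⟨z, hz, hzS⟩ := ((Set.Ioo_infinite hs.1.1).sdiff hS).nonempty
        refine ⟨z, hz.1, ?_, hzS⟩
        simp only [List.mem_cons, forall_eq_or_imp]
        exact ⟨hz.2, fun t ht => hz.2.trans (hs.2.1 t ht)⟩
    refine ⟨z :: m, by simp [hm], ?_, ?_⟩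
    · rw [List.pairwise_cons] at hs
      rw [List.cons_append, List.pairwise_cons, List.pairwise_cons]
      refine ⟨?_, hz, hs.2⟩
      simp only [List.mem_cons, forall_eq_or_imp]
      exact ⟨hxz, hs.1⟩
    · simp only [List.mem_cons, forall_eq_or_imp]
      exact ⟨hzS, hmS⟩

/-- Every word in the block substitution of the word of `X` can be read, as far as `X` is concerned,
along a refinement of the list of points. -/
theorem exists_points_of_mem_blocks [DenselyOrdered I] [NoMaxOrder I] {X : V → Finset I}
    (hX : (⋃ v, (X v : Set I)).Finite) (p : List I) (hp : p.Pairwise (· < ·))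
    (w : List (Set (Option V))) (hw : w ∈ ((p.map (letter X)).map blocks).prod) :
    ∃ q : List I, q.Pairwise (· < ·) ∧ p ⊆ q ∧ q.head? = p.head? ∧
      q.map (letter X) = w.map (some ⁻¹' ·) := by
  induction p generalizing w with
  | nil =>
    obtain rfl : w = [] := by simpa using hw
    exact ⟨[], by simp⟩
  | cons x p ih =>
    rw [List.map_cons, mem_prod_map_blocks_cons] at hw
    obtain ⟨b, u, w', rfl, hb, hu, hw'⟩ := hw
    obtain ⟨hxp, hp⟩ := List.pairwise_cons.1 hp
    obtain ⟨q, hq, hpq, hh, hl⟩ := ih hp w' hw'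
    have hxq : (x :: q).Pairwise (· < ·) := by
      refine List.pairwise_cons.2 ⟨?_, hq⟩
      match q, p, hh, hxp, hq with
      | [], _, _, _, _ => simp
      | y :: q, [], hh, _, _ => simp at hh
      | y :: q, y' :: p, hh, hxp, hq =>
        obtain rfl : y = y' := by simpa using hh
        simp only [List.mem_cons, forall_eq_or_imp] at hxp ⊢
        exact ⟨hxp.1, fun z hz => hxp.1.trans ((List.pairwise_cons.1 hq).1 z hz)⟩
    obtain ⟨m, hm, hs, hmX⟩ := exists_insert_points hX hxq u.length
    refine ⟨x :: (m ++ q), hs, ?_, rfl, ?_⟩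
    · intro y hy
      rcases List.mem_cons.1 hy with rfl | hy
      · simp
      · simp [hpq hy]
    · rw [List.map_cons, List.map_cons, List.map_append, List.map_append, hl, hb]
      congr 2
      rw [List.map_congr_left (g := fun _ => (∅ : Set V)) hu, List.map_const', ← hm,
        ← List.map_const']
      refine List.map_congr_left fun z hz => ?_
      ext v
      simp only [mem_letter, Set.mem_empty_iff_false, iff_false]
      exact fun hv => hmX z hz (Set.mem_iUnion.2 ⟨v, hv⟩)

/-- A finite set of points of `q` may be prescribed by saying for each position whether it is
chosen. -/
theorem exists_finset_of_marking (q : List I) (hq : q.Nodup) (t : List Prop)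
    (ht : t.length = q.length) : ∃ Y : Finset I, (∀ y ∈ Y, y ∈ q) ∧ q.map (· ∈ Y) = t := by
  classical
  induction q generalizing t with
  | nil => exact ⟨∅, by simp, (List.length_eq_zero_iff.1 ht).symm⟩
  | cons x q ih =>
    match t, ht with
    | c :: t, ht =>
      obtain ⟨hxq, hq⟩ := List.nodup_cons.1 hq
      obtain ⟨Y, hY, hYt⟩ := ih hq t (by simpa using ht)
      have hxY : x ∉ Y := fun h => hxq (hY x h)
      by_cases hc : c
      · refine ⟨insert x Y, by simpa using fun y hy => Or.inr (hY y hy), ?_⟩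
        rw [List.map_cons, ← hYt]
        congr 1
        · simp [hc]
        · refine List.map_congr_left fun y hy => ?_
          have : y ≠ x := by rintro rfl; exact hxq hy
          simp [this]
      · refine ⟨Y, fun y hy => List.mem_cons_of_mem _ (hY y hy), ?_⟩
        rw [List.map_cons, hYt]
        simp [hc, hxY]

variable [OrderBot I]

theorem exists_increasing_list (S : Finset I) :
    ∃ p : List I, (⊥ :: p).Pairwise (· < ·) ∧ ∀ x, x ∈ (⊥ :: p : List I) ↔ x = ⊥ ∨ x ∈ S := by
  classical
  refine ⟨(S.erase ⊥).sort, ?_, fun x => ?_⟩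
  · refine List.pairwise_cons.2 ⟨fun x hx => ?_, (Finset.sortedLT_sort _).pairwise⟩
    rw [Finset.mem_sort, Finset.mem_erase] at hx
    exact bot_lt_iff_ne_bot.2 hx.1
  · rw [List.mem_cons, Finset.mem_sort, Finset.mem_erase]
    tauto

theorem Recognizable.not {P : (V → Finset I) → Prop} (h : Recognizable P) :
    Recognizable fun X => ¬ P X := by
  obtain ⟨L, hL, H⟩ := h
  exact ⟨_, isRegular_compl hL, fun X p hp hX => not_congr (H X p hp hX)⟩

theorem Recognizable.and {P Q : (V → Finset I) → Prop} (hP : Recognizable P)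
    (hQ : Recognizable Q) : Recognizable fun X => P X ∧ Q X := by
  obtain ⟨L, hL, H⟩ := hP
  obtain ⟨K, hK, H'⟩ := hQ
  exact ⟨_, isRegular_and hL hK, fun X p hp hX => and_congr (H X p hp hX) (H' X p hp hX)⟩

theorem Recognizable.congr {P Q : (V → Finset I) → Prop} (hP : Recognizable P)
    (h : ∀ X, Q X ↔ P X) : Recognizable Q := by
  rwa [show Q = P from funext fun X => propext (h X)]

theorem Recognizable.reindex {P : (V → Finset I) → Prop} (hP : Recognizable P) (f : V → W) :
    Recognizable fun X : W → Finset I => P fun v => X (f v) := by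
  obtain ⟨L, hL, H⟩ := hP
  refine ⟨_, isRegular_comap hL (fun a => f ⁻¹' a), fun X p hp hX => ?_⟩
  refine (H _ p hp fun v => hX (f v)).trans ?_
  change _ ↔ ((⊥ :: p).map (letter X)).map (fun a => f ⁻¹' a) ∈ L
  rw [List.map_map]
  rfl

/-- The existential quantifier over finite sets preserves recognizability. Subsets of the given
points alone would not do: the letters of each block after the first stand for points outside the
list, which may belong to the new set. -/
theorem Recognizable.exists [Finite V] [DenselyOrdered I] [NoMaxOrder I]
    {P : (V → Finset I) → Finset I → Prop}
    (hP : Recognizable fun X : Option V → Finset I => P (fun v => X (some v)) (X none)) :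
    Recognizable fun X : V → Finset I => ∃ Y, P X Y := by
  classical
  obtain ⟨L, hL, H⟩ := hP
  refine ⟨_, isRegular_substitution hL blocks, fun X p hp hX => ?_⟩
  change _ ↔ ∃ w ∈ (((⊥ :: p).map (letter X)).map blocks).prod, w ∈ L
  constructor
  · rintro ⟨Y, hY⟩
    let Z : Option V → Finset I := fun o => o.elim Y X
    obtain ⟨q, hq, hqm⟩ := exists_increasing_list (p.toFinset ∪ Y)
    -- Read `X` and `Y` together along the points of `p` and `Y`.
    have hsub : (⊥ :: p).Sublist (⊥ :: q) := by
      have hsp : (⊥ :: p).Subperm (⊥ :: q) := by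
        refine List.subperm_of_subset (hp.imp fun h => h.ne) fun x hx => (hqm x).2 ?_
        rcases List.mem_cons.1 hx with rfl | hx
        · exact Or.inl rfl
        · exact Or.inr (by simp [hx])
      exact List.sublist_of_subperm_of_pairwise hsp hp hq
    have hpq := List.cons_sublist_cons.1 hsub
    have hqn : (⊥ :: q).Nodup := hq.imp fun h => h.ne
    obtain ⟨u, w, h1, h2, h3⟩ := sublist_word_mem_blocks (X := Z) hpq (List.nodup_cons.1 hqn).2
      fun v x hx hxq => by
        rcases List.mem_cons.1 (hX v x hx) with rfl | h
        · exact absurd hxq (List.nodup_cons.1 hqn).1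
        · exact h
    refine ⟨(⊥ :: q).map (letter Z), ?_, (H Z q hq ?_).1 hY⟩
    · rw [List.map_cons (l := p), mem_prod_map_blocks_cons]
      exact ⟨_, u, w, by rw [List.map_cons, h1], rfl, h2, h3⟩
    · rintro (_ | v) x hx
      · exact (hqm x).2 (Or.inr (Finset.mem_union_right _ hx))
      · exact hsub.subset (hX v x hx)
  · rintro ⟨w, hw, hwL⟩
    obtain ⟨q, hq, hpq, hh, hl⟩ :=
      exists_points_of_mem_blocks (Set.finite_iUnion fun v => (X v).finite_toSet) _ hp w hw
    obtain ⟨q, rfl⟩ : ∃ q', q = ⊥ :: q' := by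
      match q, hh with
      | y :: q, hh => exact ⟨q, by simpa using hh⟩
    -- The letters of `w` that contain `none` mark the members of the new set.
    obtain ⟨Y, hYq, hY⟩ := exists_finset_of_marking (⊥ :: q) (hq.imp fun h => h.ne)
      (w.map (none ∈ ·)) (by simpa using (congrArg List.length hl).symm)
    let Z : Option V → Finset I := fun o => o.elim Y X
    refine ⟨Y, (H Z q hq ?_).2 ?_⟩
    · rintro (_ | v) x hx
      · exact hYq x hx
      · exact hpq (hX v x hx)
    · convert hwL using 1
      generalize ⊥ :: q = q at hl hY
      clear hwL hw hq hpq hh hYq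
      induction q generalizing w with
      | nil => simpa using hl.symm
      | cons x q ih =>
        match w, hl, hY with
        | b :: w, hl, hY =>
          simp only [List.map_cons, List.cons.injEq] at hl hY ⊢
          refine ⟨?_, ih w hl.2 hY.2⟩
          ext (_ | v)
          · exact iff_of_eq hY.1
          · exact Set.ext_iff.1 hl.1 v

theorem recognizable_subset (v w : V) : Recognizable fun X : V → Finset I => X v ⊆ X w := by
  refine ⟨_, isRegular_forall_mem fun a => v ∈ a → w ∈ a, fun X p hp hX => ?_⟩
  change _ ↔ ∀ a ∈ (⊥ :: p).map (letter X), v ∈ a → w ∈ a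
  simp only [List.mem_map, forall_exists_index, and_imp, forall_apply_eq_imp_iff₂, mem_letter]
  exact ⟨fun h x _ hx => h hx, fun h x hx => h x (hX v x hx) hx⟩

theorem recognizable_empty (v : V) : Recognizable fun X : V → Finset I => X v = ∅ := by
  refine ⟨_, isRegular_forall_mem fun a => v ∉ a, fun X p hp hX => ?_⟩
  change _ ↔ ∀ a ∈ (⊥ :: p).map (letter X), v ∉ a
  simp only [List.mem_map, forall_exists_index, and_imp, forall_apply_eq_imp_iff₂, mem_letter,
    Finset.eq_empty_iff_forall_notMem]
  exact ⟨fun h x _ => h x, fun h x hx => h x (hX v x hx) hx⟩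

theorem recognizable_lt (v w : V) :
    Recognizable fun X : V → Finset I => ∃ x ∈ X v, ∃ y ∈ X w, x < y := by
  have : Recognizable fun X : V → Finset I => ∀ x ∈ X v, ∀ y ∈ X w, ¬ x < y := by
    refine ⟨_, isRegular_pairwise (fun a => v ∈ a) (fun a => w ∈ a), fun X p hp hX => ?_⟩
    change _ ↔ ((⊥ :: p).map (letter X)).Pairwise fun a b => ¬ (v ∈ a ∧ w ∈ b)
    rw [List.pairwise_map]
    constructor
    · intro h
      exact hp.imp fun {x y} hxy ⟨hx, hy⟩ => h x hx y hy hxy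
    · intro h x hx y hy hxy
      -- Two members in the required order form a sublist, to which the pairwise condition applies.
      have hall : ∀ a ∈ ⊥ :: p, ∀ b ∈ ⊥ :: p, a < b → ¬ (a ∈ X v ∧ b ∈ X w) := by
        intro a ha b hb hab
        by_contra hc
        have hsub : [a, b].Sublist (⊥ :: p) :=
          List.sublist_of_subperm_of_pairwise
            (List.subperm_of_subset (by simp [hab.ne])
              (List.cons_subset.2 ⟨ha, List.cons_subset.2 ⟨hb, List.nil_subset _⟩⟩))
            (by simpa using hab) hp
        have := h.sublist hsub
        simp only [List.pairwise_pair, mem_letter] at this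
        exact this hc
      exact hall x (hX v x hx) y (hX w y hy) hxy ⟨hx, hy⟩
  exact this.not.congr fun X => by push Not; rfl

theorem recognizable_singleton (v : V) : Recognizable fun X : V → Finset I => ∃ x, X v = {x} := by
  refine ((recognizable_empty v).not.and (recognizable_lt v v).not).congr fun X => ?_
  constructor
  · rintro ⟨x, hx⟩
    simp [hx]
  · rintro ⟨h, h'⟩
    obtain ⟨x, hx⟩ := Finset.nonempty_iff_ne_empty.2 h
    refine ⟨x, Finset.eq_singleton_iff_unique_mem.2 ⟨hx, fun y hy => ?_⟩⟩
    push Not at h'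
    exact le_antisymm (h' x hx y hy) (h' y hy x hx)

end Words

/-! ### Convex components of finite unions of closed intervals -/

section Components

variable {I : Type u} [LinearOrder I]

theorem IsFCI.exists_isLeast [OrderBot I] {A : Set I} (hA : IsFCI A) (h : A.Nonempty) :
    ∃ a, IsLeast A a := by
  obtain ⟨F, hF, hF', rfl⟩ := hA
  have hfin : {x | ∃ S ∈ F, IsLeast S x}.Finite := by
    refine (hF.biUnion fun S _ => (minSet_subsingleton S).finite).subset ?_
    rintro x ⟨S, hS, hx⟩
    exact Set.mem_biUnion hS hx
  have hmin : ∀ x ∈ ⋃₀ F, ∃ a ∈ {x | ∃ S ∈ F, IsLeast S x}, a ≤ x := by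
    rintro x ⟨S, hS, hx⟩
    rcases hF' S hS with ⟨i, j, rfl⟩ | ⟨i, rfl⟩ | ⟨j, rfl⟩
    · exact ⟨i, ⟨_, hS, isLeast_Icc (hx.1.trans hx.2)⟩, hx.1⟩
    · exact ⟨i, ⟨_, hS, isLeast_Ici⟩, hx⟩
    · exact ⟨⊥, ⟨_, hS, by simp, fun _ _ => bot_le⟩, bot_le⟩
  obtain ⟨x, hx⟩ := h
  obtain ⟨a₀, ha₀, -⟩ := hmin x hx
  obtain ⟨a, ha, hle⟩ := Set.exists_min_image _ id hfin ⟨a₀, ha₀⟩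
  refine ⟨a, ?_, fun y hy => ?_⟩
  · obtain ⟨S, hS, h⟩ := ha
    exact ⟨S, hS, h.1⟩
  · obtain ⟨b, hb, hby⟩ := hmin y hy
    exact (hle b hb).trans hby

theorem IsFCI.exists_isGreatest [NoMaxOrder I] {A : Set I} (hA : IsFCI A) (h : A.Nonempty)
    (hb : BddAbove A) : ∃ a, IsGreatest A a := by
  obtain ⟨F, hF, hF', rfl⟩ := hA
  have hfin : {x | ∃ S ∈ F, IsGreatest S x}.Finite := by
    refine (hF.biUnion fun S _ => (maxSet_subsingleton S).finite).subset ?_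
    rintro x ⟨S, hS, hx⟩
    exact Set.mem_biUnion hS hx
  have hmax : ∀ x ∈ ⋃₀ F, ∃ a ∈ {x | ∃ S ∈ F, IsGreatest S x}, x ≤ a := by
    rintro x ⟨S, hS, hx⟩
    rcases hF' S hS with ⟨i, j, rfl⟩ | ⟨i, rfl⟩ | ⟨j, rfl⟩
    · exact ⟨j, ⟨_, hS, isGreatest_Icc (hx.1.trans hx.2)⟩, hx.2⟩
    · exact absurd (hb.mono (Set.subset_sUnion_of_mem hS)) (not_bddAbove_Ici i)
    · exact ⟨j, ⟨_, hS, isGreatest_Iic⟩, hx⟩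
  obtain ⟨x, hx⟩ := h
  obtain ⟨a₀, ha₀, -⟩ := hmax x hx
  obtain ⟨a, ha, hle⟩ := Set.exists_max_image _ id hfin ⟨a₀, ha₀⟩
  refine ⟨a, ?_, fun y hy => ?_⟩
  · obtain ⟨S, hS, h⟩ := ha
    exact ⟨S, hS, h.1⟩
  · obtain ⟨b, hb, hby⟩ := hmax y hy
    exact hby.trans (hle b hb)

/-- A convex component is the union of those closed intervals of the given family that it
contains. -/
theorem IsFCI.ordConnectedComponent {A : Set I} (hA : IsFCI A) (x : I) :
    IsFCI (A.ordConnectedComponent x) := by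
  obtain ⟨F, hF, hF', rfl⟩ := hA
  refine ⟨{S ∈ F | S ⊆ (⋃₀ F).ordConnectedComponent x}, hF.subset fun S hS => hS.1,
    fun S hS => hF' S hS.1, Set.Subset.antisymm (fun y hy => ?_)
      (Set.sUnion_subset fun S hS => hS.2)⟩
  obtain ⟨S, hS, hyS⟩ := Set.ordConnectedComponent_subset hy
  refine ⟨S, ⟨hS, fun z hz => ?_⟩, hyS⟩
  exact Set.mem_ordConnectedComponent_trans hy
    (((hF' S hS).ordConnected.uIcc_subset hyS hz).trans (Set.subset_sUnion_of_mem hS))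

theorem mem_leftEndpoints_iff {A : Set I} {x : I} :
    x ∈ leftEndpoints A ↔ x ∈ A ∧ ∀ y, y < x → ∃ z, y ≤ z ∧ z ≤ x ∧ z ∉ A := by
  constructor
  · intro h
    refine ⟨mem_of_mem_ordConnectedComponent_self h.1, fun y hy => ?_⟩
    by_contra! hc
    refine hy.not_ge (h.2 (?_ : y ∈ A.ordConnectedComponent x))
    rw [Set.mem_ordConnectedComponent, Set.uIcc_of_ge hy.le]
    exact fun z hz => hc z hz.1 hz.2
  · rintro ⟨hx, h⟩
    refine ⟨Set.self_mem_ordConnectedComponent.2 hx, fun y hy => ?_⟩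
    by_contra! hc
    obtain ⟨z, hz, hz', hzA⟩ := h y hc
    rw [Set.mem_ordConnectedComponent, Set.uIcc_of_ge hc.le] at hy
    exact hzA (hy ⟨hz, hz'⟩)

theorem mem_rightEndpoints_iff {A : Set I} {x : I} :
    x ∈ rightEndpoints A ↔ x ∈ A ∧ ∀ y, x < y → ∃ z, x ≤ z ∧ z ≤ y ∧ z ∉ A := by
  constructor
  · intro h
    refine ⟨mem_of_mem_ordConnectedComponent_self h.1, fun y hy => ?_⟩
    by_contra! hc
    refine hy.not_ge (h.2 (?_ : y ∈ A.ordConnectedComponent x))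
    rw [Set.mem_ordConnectedComponent, Set.uIcc_of_le hy.le]
    exact fun z hz => hc z hz.1 hz.2
  · rintro ⟨hx, h⟩
    refine ⟨Set.self_mem_ordConnectedComponent.2 hx, fun y hy => ?_⟩
    by_contra! hc
    obtain ⟨z, hz, hz', hzA⟩ := h y hc
    rw [Set.mem_ordConnectedComponent, Set.uIcc_of_le hc.le] at hy
    exact hzA (hy ⟨hz, hz'⟩)

theorem IsFCI.exists_leftEndpoint [OrderBot I] {A : Set I} (hA : IsFCI A) {x : I} (hx : x ∈ A) :
    ∃ a ∈ leftEndpoints A, a ≤ x ∧ Set.Icc a x ⊆ A := by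
  have hx' := Set.self_mem_ordConnectedComponent.2 hx
  obtain ⟨a, ha⟩ := (hA.ordConnectedComponent x).exists_isLeast ⟨x, hx'⟩
  have hax := ha.2 hx'
  refine ⟨a, ?_, hax, ?_⟩
  · change IsLeast (A.ordConnectedComponent a) a
    rwa [← Set.ordConnectedComponent_eq ha.1]
  · have := ha.1
    rwa [Set.mem_ordConnectedComponent, Set.uIcc_of_ge hax] at this

theorem IsFCI.exists_rightEndpoint [NoMaxOrder I] {A : Set I} (hA : IsFCI A) {x : I}
    (hx : x ∈ A) :
    Set.Ici x ⊆ A ∨ ∃ b ∈ rightEndpoints A, x ≤ b ∧ Set.Icc x b ⊆ A := by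
  have hx' := Set.self_mem_ordConnectedComponent.2 hx
  by_cases hb : BddAbove (A.ordConnectedComponent x)
  · obtain ⟨b, hb⟩ := (hA.ordConnectedComponent x).exists_isGreatest ⟨x, hx'⟩ hb
    have hxb := hb.2 hx'
    refine Or.inr ⟨b, ?_, hxb, ?_⟩
    · change IsGreatest (A.ordConnectedComponent b) b
      rwa [← Set.ordConnectedComponent_eq hb.1]
    · have := hb.1
      rwa [Set.mem_ordConnectedComponent, Set.uIcc_of_le hxb] at this
  · refine Or.inl fun y hy => ?_
    rw [not_bddAbove_iff] at hb
    obtain ⟨z, hz, hyz⟩ := hb y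
    rw [Set.mem_ordConnectedComponent, Set.uIcc_of_le (le_trans hy hyz.le)] at hz
    exact hz ⟨hy, hyz.le⟩

/-- The set with left endpoints in `L` that is cut off at the points of `R`: the union over
`a ∈ L` of `[a, b]`, where `b` is the first point of `R` not below `a`, or of `[a, +∞)` if there is
no such point. -/
def decode (L R : Finset I) : Set I := {x | ∃ a ∈ L, a ≤ x ∧ ∀ b ∈ R, a ≤ b → x ≤ b}

theorem isFCI_decode (L R : Finset I) : IsFCI (decode L R) := by
  refine ⟨(fun a => {x | a ≤ x ∧ ∀ b ∈ R, a ≤ b → x ≤ b}) '' L, L.finite_toSet.image _, ?_, ?_⟩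
  · rintro _ ⟨a, -, rfl⟩
    rcases (R.filter (a ≤ ·)).eq_empty_or_nonempty with h | h
    · refine Or.inr (Or.inl ⟨a, ?_⟩)
      ext x
      refine ⟨fun hx => hx.1, fun hx => ⟨hx, fun b hb hab => ?_⟩⟩
      exact absurd (Finset.mem_filter.2 ⟨hb, hab⟩) (by simp [h])
    · have hm := Finset.mem_filter.1 (Finset.min'_mem _ h)
      refine Or.inl ⟨a, (R.filter (a ≤ ·)).min' h, ?_⟩
      ext x
      refine ⟨fun hx => ⟨hx.1, hx.2 _ hm.1 hm.2⟩, fun hx => ⟨hx.1, fun b hb hab => ?_⟩⟩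
      exact hx.2.trans (Finset.min'_le _ _ (Finset.mem_filter.2 ⟨hb, hab⟩))
  · ext x
    simp [decode, and_left_comm]

/-- `decode` as a finite union of closed intervals. -/
def decodeFCI (L R : Finset I) : FCI I := ⟨decode L R, isFCI_decode L R⟩

/-- The finite set of left endpoints of a finite union of closed intervals (`false`), or of its
right endpoints (`true`). -/
noncomputable def endpoints (A : FCI I) : Bool → Finset I
  | false => (leftEndpoints_finite A.2).toFinset
  | true => (rightEndpoints_finite A.2).toFinset

/-- A finite union of closed intervals is determined by its left and right endpoints. -/
theorem decodeFCI_endpoints [OrderBot I] [NoMaxOrder I] (A : FCI I) :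
    decodeFCI (endpoints A false) (endpoints A true) = A := by
  refine Subtype.ext (Set.ext fun x => ?_)
  simp only [decodeFCI, decode, endpoints, Set.Finite.mem_toFinset, Set.mem_ofPred_eq]
  constructor
  · rintro ⟨a, ha, hax, h⟩
    rcases A.2.exists_rightEndpoint (mem_leftEndpoints_iff.1 ha).1 with h' | ⟨b, hb, hab, h'⟩
    · exact h' hax
    · exact h' ⟨hax, h b hb hab⟩
  · intro hx
    obtain ⟨a, ha, hax, h⟩ := A.2.exists_leftEndpoint hx
    refine ⟨a, ha, hax, fun b hb hab => ?_⟩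
    by_contra! hbx
    obtain ⟨z, hz, hz', hzA⟩ := (mem_rightEndpoints_iff.1 hb).2 x hbx
    exact hzA (h ⟨hab.trans hz, hz'⟩)

end Components

/-! ### Recognizable predicates on points and sets -/

section Points

variable {I : Type u} [LinearOrder I] [OrderBot I] {V W : Type} {k l : ℕ}

/-- A predicate on `k` points and a tuple of finite sets is recognizable if it is given by a
recognizable predicate in which each point is replaced by its singleton. -/
def PointRecognizable (Φ : (Fin k → I) → (V → Finset I) → Prop) : Prop :=
  ∃ Q : (Fin k ⊕ V → Finset I) → Prop, Recognizable Q ∧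
    ∀ x X, Φ x X ↔ Q (Sum.elim (fun i => {x i}) X)

namespace PointRecognizable

variable {Φ Ψ : (Fin k → I) → (V → Finset I) → Prop}

theorem congr (h : PointRecognizable Φ) (h' : ∀ x X, Ψ x X ↔ Φ x X) : PointRecognizable Ψ := by
  rwa [show Ψ = Φ from funext fun x => funext fun X => propext (h' x X)]

theorem not (h : PointRecognizable Φ) : PointRecognizable fun x X => ¬ Φ x X := by
  obtain ⟨Q, hQ, H⟩ := h
  exact ⟨_, hQ.not, fun x X => not_congr (H x X)⟩

theorem and (h : PointRecognizable Φ) (h' : PointRecognizable Ψ) :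
    PointRecognizable fun x X => Φ x X ∧ Ψ x X := by
  obtain ⟨Q, hQ, H⟩ := h
  obtain ⟨Q', hQ', H'⟩ := h'
  exact ⟨_, hQ.and hQ', fun x X => and_congr (H x X) (H' x X)⟩

theorem imp (h : PointRecognizable Φ) (h' : PointRecognizable Ψ) :
    PointRecognizable fun x X => Φ x X → Ψ x X :=
  (h.and h'.not).not.congr fun x X => by tauto

theorem or (h : PointRecognizable Φ) (h' : PointRecognizable Ψ) :
    PointRecognizable fun x X => Φ x X ∨ Ψ x X :=
  (h.not.and h'.not).not.congr fun x X => by tauto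

theorem reindex (h : PointRecognizable Φ) (f : Fin k → Fin l) (g : V → W) :
    PointRecognizable fun x X => Φ (fun i => x (f i)) (fun v => X (g v)) := by
  obtain ⟨Q, hQ, H⟩ := h
  refine ⟨_, hQ.reindex (Sum.map f g), fun x X => (H _ _).trans (iff_of_eq (congrArg Q ?_))⟩
  ext1 (i | v) <;> rfl

theorem exists_point [Finite V] [DenselyOrdered I] [NoMaxOrder I]
    {Φ : (Fin k → I) → (V → Finset I) → I → Prop}
    (h : PointRecognizable fun (x : Fin (k + 1) → I) X => Φ (fun i => x i.succ) X (x 0)) :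
    PointRecognizable fun x X => ∃ y, Φ x X y := by
  obtain ⟨Q, hQ, H⟩ := h
  let f : Fin (k + 1) ⊕ V → Option (Fin k ⊕ V) :=
    Sum.elim (Fin.cases none fun i => some (Sum.inl i)) fun v => some (Sum.inr v)
  let P : (Fin k ⊕ V → Finset I) → Finset I → Prop := fun X Y =>
    (∃ y, Y = {y}) ∧ Q fun i => (f i).elim Y X
  have hP : Recognizable fun X : Option (Fin k ⊕ V) → Finset I =>
      P (fun v => X (some v)) (X none) := by
    refine (recognizable_singleton none).and ((hQ.reindex f).congr fun X => ?_)
    refine iff_of_eq (congrArg Q (funext fun i => ?_))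
    cases f i <;> rfl
  refine ⟨_, hP.exists, fun x X => ?_⟩
  simp only [P]
  have key : ∀ y, Φ x X y ↔ Q fun i => (f i).elim {y} (Sum.elim (fun i => {x i}) X) := by
    intro y
    refine (H (Fin.cons y x) X).trans (iff_of_eq (congrArg Q ?_))
    ext1 (i | v)
    · refine Fin.cases rfl (fun i => rfl) i
    · rfl
  constructor
  · rintro ⟨y, hy⟩
    exact ⟨{y}, ⟨y, rfl⟩, (key y).1 hy⟩
  · rintro ⟨_, ⟨y, rfl⟩, hy⟩
    exact ⟨y, (key y).2 hy⟩

theorem forall_point [Finite V] [DenselyOrdered I] [NoMaxOrder I]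
    {Φ : (Fin k → I) → (V → Finset I) → I → Prop}
    (h : PointRecognizable fun (x : Fin (k + 1) → I) X => Φ (fun i => x i.succ) X (x 0)) :
    PointRecognizable fun x X => ∀ y, Φ x X y :=
  (exists_point (Φ := fun x X y => ¬ Φ x X y) h.not).not.congr fun x X => by simp

theorem lt (i j : Fin k) : PointRecognizable fun (x : Fin k → I) (_ : V → Finset I) => x i < x j :=
  ⟨_, recognizable_lt (Sum.inl i) (Sum.inl j), fun x X => by simp⟩

theorem le (i j : Fin k) : PointRecognizable fun (x : Fin k → I) (_ : V → Finset I) => x i ≤ x j :=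
  (lt j i).not.congr fun x X => by simp

theorem mem (i : Fin k) (v : V) : PointRecognizable fun (x : Fin k → I) X => x i ∈ X v :=
  ⟨_, recognizable_subset (Sum.inl i) (Sum.inr v), fun x X => by simp⟩

theorem recognizable {P : (V → Finset I) → Prop}
    (h : PointRecognizable fun (_ : Fin 0 → I) X => P X) : Recognizable P := by
  obtain ⟨Q, hQ, H⟩ := h
  refine (hQ.reindex (Sum.elim Fin.elim0 id)).congr fun X => (H Fin.elim0 X).trans ?_
  refine iff_of_eq (congrArg Q (funext ?_))
  rintro (i | v)
  · exact i.elim0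
  · rfl

end PointRecognizable

/-- A set depending on a tuple of finite sets is recognizable if membership in it is. -/
def RecognizableSet (T : (V → Finset I) → Set I) : Prop :=
  PointRecognizable fun (x : Fin 1 → I) X => x 0 ∈ T X

namespace RecognizableSet

variable {T T' : (V → Finset I) → Set I}

theorem mem (h : RecognizableSet T) (i : Fin k) : PointRecognizable fun x X => x i ∈ T X :=
  h.reindex (fun _ => i) id

theorem union (h : RecognizableSet T) (h' : RecognizableSet T') :
    RecognizableSet fun X => T X ∪ T' X :=
  PointRecognizable.or h h'

theorem inter (h : RecognizableSet T) (h' : RecognizableSet T') :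
    RecognizableSet fun X => T X ∩ T' X :=
  PointRecognizable.and h h'

theorem empty : RecognizableSet fun _ : V → Finset I => (∅ : Set I) :=
  (PointRecognizable.lt 0 0).congr fun x X => by simp

variable [Finite V] [DenselyOrdered I] [NoMaxOrder I]

theorem bot : RecognizableSet fun _ : V → Finset I => ({⊥} : Set I) := by
  refine PointRecognizable.congr (Φ := fun x _ => ∀ y, x 0 ≤ y) (.forall_point (.le 1 0))
    fun x X => ?_
  exact ⟨fun h y => h ▸ bot_le, fun h => le_bot_iff.1 (h ⊥)⟩

theorem decode (L R : V) : RecognizableSet fun X : V → Finset I => decode (X L) (X R) := by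
  refine .exists_point (.and (.mem _ _) (.and (.le 0 1) ?_))
  exact .forall_point (.imp (.mem _ _) (.imp (.le 1 0) (.le 2 0)))

theorem minSet (h : RecognizableSet T) : RecognizableSet fun X => minSet (T X) := by
  refine .and h (.forall_point (.imp (h.mem 0) (.le 1 0)))

theorem maxSet (h : RecognizableSet T) : RecognizableSet fun X => maxSet (T X) := by
  refine .and h (.forall_point (.imp (h.mem 0) (.le 0 1)))

theorem leftEndpoints (h : RecognizableSet T) :
    RecognizableSet fun X => leftEndpoints (T X) := by
  refine PointRecognizable.congr ?_ fun x X => mem_leftEndpoints_iff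
  refine .and h (.forall_point (.imp (.lt 0 1) (.exists_point ?_)))
  exact .and (.le 1 0) (.and (.le 0 2) (h.mem 0).not)

theorem rightEndpoints (h : RecognizableSet T) :
    RecognizableSet fun X => rightEndpoints (T X) := by
  refine PointRecognizable.congr ?_ fun x X => mem_rightEndpoints_iff
  refine .and h (.forall_point (.imp (.lt 1 0) (.exists_point ?_)))
  exact .and (.le 2 0) (.and (.le 0 1) (h.mem 0).not)

theorem eq (h : RecognizableSet T) (h' : RecognizableSet T') :
    Recognizable fun X => T X = T' X := by
  refine PointRecognizable.recognizable ?_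
  refine PointRecognizable.congr (Φ := fun _ X => ∀ y, (y ∈ T X → y ∈ T' X) ∧ (y ∈ T' X → y ∈ T X))
    (.forall_point (.and (.imp (h.mem 0) (h'.mem 0)) (.imp (h'.mem 0) (h.mem 0)))) fun x X => ?_
  simp only [← iff_def, Set.ext_iff]

end RecognizableSet

end Points

/-! ### Formulas define recognizable predicates -/

section Formulas

variable {I : Type u} [LinearOrder I] {V : Type}

/-- The tuple of finite unions of closed intervals coded by a tuple of pairs of finite sets. -/
def decodeTuple (Z : V × Bool → Finset I) (v : V) : FCI I :=
  decodeFCI (Z (v, false)) (Z (v, true))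

variable [OrderBot I] [DenselyOrdered I] [NoMaxOrder I]

theorem recognizableSet_term [Finite V] (t : langL.Term V) :
    RecognizableSet fun Z : V × Bool → Finset I => (t.realize (decodeTuple Z)).1 := by
  induction t with
  | var v => exact RecognizableSet.decode (v, false) (v, true)
  | func f ts ih =>
    cases f with
    | union => exact (ih 0).union (ih 1)
    | inter => exact (ih 0).inter (ih 1)
    | bot => exact .empty
    | zero => exact .bot
    | min => exact (ih 0).minSet
    | max => exact (ih 0).maxSet
    | left => exact (ih 0).leftEndpoints
    | right => exact (ih 0).rightEndpoints

/-- Quantifiers over finite unions of closed intervals become pairs of quantifiers over finite sets,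
since every pair `(L, R)` is the code of some finite union, and every finite union has a code. -/
theorem recognizable_formula {α : Type} [Finite α] {n : ℕ} (φ : langL.BoundedFormula α n) :
    Recognizable fun Z : (α ⊕ Fin n) × Bool → Finset I =>
      φ.Realize (fun a => decodeTuple Z (Sum.inl a)) (fun i => decodeTuple Z (Sum.inr i)) := by
  induction φ with
  | falsum =>
    refine (RecognizableSet.eq .empty .bot).congr fun Z => ?_
    simp only [FirstOrder.Language.BoundedFormula.Realize, false_iff]
    exact (Set.singleton_ne_empty _).symm
  | equal t₁ t₂ =>
    refine ((recognizableSet_term t₁).eq (recognizableSet_term t₂)).congr fun Z => ?_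
    refine Iff.trans ?_ Subtype.ext_iff
    refine iff_of_eq (congrArg₂ (· = ·) ?_ ?_) <;>
      refine congrArg (FirstOrder.Language.Term.realize · _) (funext ?_) <;> rintro (a | i) <;> rfl
  | rel R => exact nomatch R
  | imp φ ψ ih ih' =>
    refine (ih.and ih'.not).not.congr fun Z => ?_
    simp only [FirstOrder.Language.BoundedFormula.Realize]
    tauto
  | @all n φ ih =>
    let f : (α ⊕ Fin (n + 1)) × Bool → Option (Option ((α ⊕ Fin n) × Bool)) := fun q =>
      q.1.elim (fun a => some (some (Sum.inl a, q.2)))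
        (Fin.lastCases (if q.2 then none else some none) fun i => some (some (Sum.inr i, q.2)))
    let P : ((α ⊕ Fin n) × Bool → Finset I) → Finset I → Finset I → Prop := fun Z L R =>
      φ.Realize (fun a => decodeTuple Z (Sum.inl a))
        (Fin.snoc (fun i => decodeTuple Z (Sum.inr i)) (decodeFCI L R))
    have h1 : Recognizable fun Z : Option (Option ((α ⊕ Fin n) × Bool)) → Finset I =>
        P (fun q => Z (some (some q))) (Z (some none)) (Z none) := by
      refine (ih.reindex f).congr fun Z => iff_of_eq (congrArg₂ _ rfl (funext fun i => ?_))
      refine Fin.lastCases ?_ (fun i => ?_) i <;> simp [decodeTuple, f]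
    have h2 : Recognizable fun Z : Option ((α ⊕ Fin n) × Bool) → Finset I =>
        ∃ R, ¬ P (fun q => Z (some q)) (Z none) R := Recognizable.exists h1.not
    have h3 : Recognizable fun Z : (α ⊕ Fin n) × Bool → Finset I =>
        ∃ L R, ¬ P Z L R := Recognizable.exists h2
    refine h3.not.congr fun Z => ?_
    simp only [FirstOrder.Language.BoundedFormula.Realize]
    push Not
    refine ⟨fun h L R => h _, fun h A => ?_⟩
    have := h (endpoints A false) (endpoints A true)
    simpa only [P, decodeFCI_endpoints] using this

end Formulas

/-! ### Runs of automata along finite sets of points -/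

section Runs

variable {I : Type u} [LinearOrder I]

/-- `y` is the next point of the list `p` after its member `x`. -/
def Consecutive (p : List I) (x y : I) : Prop :=
  x ∈ p ∧ y ∈ p ∧ x < y ∧ ∀ z ∈ p, x < z → y ≤ z

theorem isChain_iff_consecutive {p : List I} (hp : p.Pairwise (· < ·)) (R : I → I → Prop) :
    p.IsChain R ↔ ∀ x y, Consecutive p x y → R x y := by
  induction p with
  | nil => simp [Consecutive]
  | cons a p ih =>
    cases p with
    | nil =>
      simp only [List.isChain_singleton, true_iff]
      rintro x y ⟨hx, hy, hxy, -⟩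
      simp only [List.mem_singleton] at hx hy
      exact absurd hxy (by simp [hx, hy])
    | cons b p =>
      obtain ⟨ha, hp'⟩ := List.pairwise_cons.1 hp
      obtain ⟨hb, -⟩ := List.pairwise_cons.1 hp'
      rw [List.isChain_cons_cons, ih hp']
      constructor
      · rintro ⟨hab, h⟩ x y ⟨hx, hy, hxy, hn⟩
        rcases List.mem_cons.1 hx with rfl | hx
        · have hyb : y ∈ b :: p := (List.mem_cons.1 hy).resolve_left hxy.ne'
          have h1 := hn b (by simp) (ha b (by simp))
          rcases List.mem_cons.1 hyb with rfl | hyp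
          · exact hab
          · exact absurd (hb y hyp) h1.not_gt
        · have hyb : y ∈ b :: p :=
            (List.mem_cons.1 hy).resolve_left ((ha x hx).trans hxy).ne'
          exact h x y ⟨hx, hyb, hxy, fun z hz => hn z (List.mem_cons_of_mem _ hz)⟩
      · refine fun h => ⟨h a b ⟨by simp, by simp, ha b (by simp), ?_⟩, ?_⟩
        · intro z hz haz
          rcases List.mem_cons.1 ((List.mem_cons.1 hz).resolve_left haz.ne') with rfl | hz
          · exact le_rfl
          · exact (hb z hz).le
        · rintro x y ⟨hx, hy, hxy, hn⟩
          refine h x y ⟨List.mem_cons_of_mem _ hx, List.mem_cons_of_mem _ hy, hxy, ?_⟩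
          intro z hz hxz
          rcases List.mem_cons.1 hz with rfl | hz
          · exact absurd (ha x hx) hxz.not_gt
          · exact hn z hz hxz

/-- A transition function can be run along an increasing list of points; the states are recorded
as a function on points. -/
theorem exists_states {σ : Type*} (step : σ → I → σ) (x : I) (p : List I)
    (hp : (x :: p).Pairwise (· < ·)) (q : σ) :
    ∃ s : I → σ, s x = q ∧ (x :: p).IsChain fun x y => s y = step (s x) x := by
  classical
  induction p generalizing x q with
  | nil => exact ⟨fun _ => q, rfl, by simp⟩
  | cons y p ih =>
    obtain ⟨hx, hp'⟩ := List.pairwise_cons.1 hp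
    obtain ⟨s, hs, h⟩ := ih y hp' (step q x)
    refine ⟨Function.update s x q, by simp, ?_⟩
    have hne : ∀ z ∈ y :: p, Function.update s x q z = s z := fun z hz =>
      Function.update_of_ne (hx z hz).ne' _ _
    rw [List.isChain_cons_cons, hne y (by simp), hs, Function.update_self]
    refine ⟨rfl, ?_⟩
    rw [isChain_iff_consecutive hp'] at h ⊢
    intro z z' hz
    rw [hne z hz.1, hne z' hz.2.1]
    exact h z z' hz

omit [LinearOrder I] in
theorem evalFrom_of_isChain {A σ : Type*} (M : DFA A σ) (a : I → A) (s : I → σ) (x : I)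
    (p : List I) (h : (x :: p).IsChain fun x y => s y = M.step (s x) (a x)) :
    M.evalFrom (s x) ((x :: p).map a) =
      M.step (s ((x :: p).getLast (by simp))) (a ((x :: p).getLast (by simp))) := by
  induction p generalizing x with
  | nil => simp
  | cons y p ih =>
    rw [List.isChain_cons_cons] at h
    rw [List.map_cons, DFA.evalFrom_cons, ← h.1, ih y h.2]
    simp

theorem le_getLast_of_pairwise {p : List I} (hp : p.Pairwise (· < ·)) (h : p ≠ []) {x : I}
    (hx : x ∈ p) : x ≤ p.getLast h := by
  induction p with
  | nil => simp at hx
  | cons a p ih =>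
    obtain ⟨ha, hp'⟩ := List.pairwise_cons.1 hp
    cases p with
    | nil => simp_all
    | cons b p =>
      rw [List.getLast_cons (by simp)]
      rcases List.mem_cons.1 hx with rfl | hx
      · exact (ha _ (List.getLast_mem _)).le
      · exact ih hp' (by simp) hx

end Runs

/-! ### Coding runs by finite unions of closed intervals -/

section Codes

variable {I : Type u} [LinearOrder I] {V σ : Type}

/-- A family of sets, indexed by a parity, a state and a letter, that codes an accepting run of the
automaton `M` on the tuple `T`. The left endpoints of the members are the points of the run; at a
left endpoint of `Z (b, q, a)` the automaton is in the state `q` and reads the letter `a`; the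
convex component starting there ends at the next point of the run. The parity changes from
point to point, which keeps the components of one member apart. The field `accept` says that a
nonempty member without a maximum carries a label from which the automaton accepts. All conditions
are written as inclusions between values of terms. -/
structure CodesRun [OrderBot I] (M : DFA (Set V) σ) (T : V → Set I)
    (Z : Bool × σ × Set V → Set I) : Prop where
  left_disjoint : ∀ j j', j ≠ j' → leftEndpoints (Z j) ∩ leftEndpoints (Z j') ⊆ ∅
  inter_left : ∀ j j', j ≠ j' → Z j ∩ leftEndpoints (Z j') ⊆ rightEndpoints (Z j)
  right_subset : ∀ j, rightEndpoints (Z j) ⊆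
    ⋃ j' ∈ {j' : Bool × σ × Set V | j'.1 ≠ j.1 ∧ j'.2.1 = M.step j.2.1 j.2.2},
      leftEndpoints (Z j')
  left_subset : ∀ j t, t ∈ j.2.2 → leftEndpoints (Z j) ⊆ T t
  left_inter : ∀ j t, t ∉ j.2.2 → leftEndpoints (Z j) ∩ T t ⊆ ∅
  subset_left : ∀ t, T t ⊆ ⋃ j ∈ (Set.univ : Set (Bool × σ × Set V)), leftEndpoints (Z j)
  bot_start : ∀ j : Bool × σ × Set V, j.2.1 ≠ M.start → {⊥} ∩ leftEndpoints (Z j) ⊆ ∅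
  bot_subset : {⊥} ⊆ ⋃ j ∈ (Set.univ : Set (Bool × σ × Set V)), leftEndpoints (Z j)
  accept : ∀ j : Bool × σ × Set V, M.step j.2.1 j.2.2 ∉ M.accept →
    ¬ (¬ Z j ⊆ ∅ ∧ maxSet (Z j) ⊆ ∅)

theorem notMem_leftEndpoints_of_Icc_subset {A : Set I} {x y : I} (hxy : x < y)
    (h : Set.Icc x y ⊆ A) : y ∉ leftEndpoints A := by
  intro hy
  obtain ⟨z, hz, hz', hzA⟩ := (mem_leftEndpoints_iff.1 hy).2 x hxy
  exact hzA (h ⟨hz, hz'⟩)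

theorem notMem_rightEndpoints_of_Icc_subset {A : Set I} {x y : I} (hxy : x < y)
    (h : Set.Icc x y ⊆ A) : x ∉ rightEndpoints A := by
  intro hy
  obtain ⟨z, hz, hz', hzA⟩ := (mem_rightEndpoints_iff.1 hy).2 y hxy
  exact hzA (h ⟨hz, hz'⟩)

namespace CodesRun

variable [OrderBot I] [NoMaxOrder I] {M : DFA (Set V) σ} {T : V → Set I}
  {Z : Bool × σ × Set V → Set I} {j j' : Bool × σ × Set V} {x y : I}

omit [NoMaxOrder I] in
theorem eq_of_mem (h : CodesRun M T Z) (hx : x ∈ leftEndpoints (Z j))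
    (hx' : x ∈ leftEndpoints (Z j')) : j = j' := by
  by_contra hne
  exact h.left_disjoint j j' hne ⟨hx, hx'⟩

omit [NoMaxOrder I] in
theorem exists_right (h : CodesRun M T Z) (hx : x ∈ rightEndpoints (Z j)) :
    ∃ j', j'.2.1 = M.step j.2.1 j.2.2 ∧ x ∈ leftEndpoints (Z j') ∧ x ∉ leftEndpoints (Z j) := by
  obtain ⟨j', hj', hx'⟩ := Set.mem_iUnion₂.1 (h.right_subset j hx)
  exact ⟨j', hj'.2, hx', fun hx'' => hj'.1 (by rw [h.eq_of_mem hx' hx''])⟩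

/-- The component of `Z j` starting at `x` ends at the next left endpoint `y` of the family, whose
label then satisfies the transition condition. -/
theorem step_of_consecutive (h : CodesRun M T Z) (hZ : ∀ j, IsFCI (Z j))
    (hx : x ∈ leftEndpoints (Z j)) (hy : y ∈ leftEndpoints (Z j')) (hxy : x < y)
    (hn : ∀ j'', ∀ z ∈ leftEndpoints (Z j''), x < z → y ≤ z) :
    j'.2.1 = M.step j.2.1 j.2.2 := by
  rcases (hZ j).exists_rightEndpoint (mem_leftEndpoints_iff.1 hx).1 with hc | ⟨b, hb, hxb, hc⟩
  · -- An unbounded component would run past the left endpoint `y` of another member.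
    have hyl := notMem_leftEndpoints_of_Icc_subset hxy (Set.Icc_subset_Ici_self.trans hc)
    have hne : j ≠ j' := by rintro rfl; exact hyl hy
    have hyr := h.inter_left j j' hne ⟨hc hxy.le, hy⟩
    obtain ⟨z, hz⟩ := exists_gt y
    exact absurd hyr (notMem_rightEndpoints_of_Icc_subset hz
      fun u hu => hc (hxy.le.trans hu.1))
  · obtain ⟨k, hk, hbk, hbj⟩ := h.exists_right hb
    have hxb' : x < b := lt_of_le_of_ne hxb (by rintro rfl; exact hbj hx)
    have hyb := hn k b hbk hxb'
    obtain rfl : y = b := by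
      by_contra hne
      have hyb' := lt_of_le_of_ne hyb hne
      have hyl := notMem_leftEndpoints_of_Icc_subset hxy
        ((Set.Icc_subset_Icc_right hyb).trans hc)
      have hne : j ≠ j' := by rintro rfl; exact hyl hy
      have hyr := h.inter_left j j' hne ⟨hc ⟨hxy.le, hyb⟩, hy⟩
      exact notMem_rightEndpoints_of_Icc_subset hyb' ((Set.Icc_subset_Icc_left hxy.le).trans hc) hyr
    rw [h.eq_of_mem hy hbk, hk]

/-- The component that starts at the last left endpoint is unbounded, so the acceptance condition
applies to its label. -/
theorem step_mem_accept (h : CodesRun M T Z) (hZ : ∀ j, IsFCI (Z j))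
    (hx : x ∈ leftEndpoints (Z j)) (hn : ∀ j', ∀ z ∈ leftEndpoints (Z j'), z ≤ x) :
    M.step j.2.1 j.2.2 ∈ M.accept := by
  have hxZ := (mem_leftEndpoints_iff.1 hx).1
  by_contra hacc
  refine h.accept j hacc ⟨fun hc => hc hxZ, ?_⟩
  rcases (hZ j).exists_rightEndpoint hxZ with hc | ⟨b, hb, hxb, -⟩
  · intro m hm
    obtain ⟨z, hz⟩ := exists_gt m
    exact absurd (hm.2 (hc ((hm.2 hxZ).trans hz.le))) hz.not_ge
  · obtain ⟨k, -, hbk, hbj⟩ := h.exists_right hb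
    rw [le_antisymm (hn k b hbk) hxb] at hbj
    exact absurd hx hbj

theorem exists_accepted [Finite σ] [Finite V] {T : V → Finset I}
    (h : CodesRun M (fun t => (T t : Set I)) Z) (hZ : ∀ j, IsFCI (Z j)) :
    ∃ p : List I, (⊥ :: p).Pairwise (· < ·) ∧ (∀ t, ∀ x ∈ T t, x ∈ (⊥ :: p : List I)) ∧
      (⊥ :: p).map (letter T) ∈ M.accepts := by
  have hfin : (⋃ j, leftEndpoints (Z j)).Finite :=
    Set.finite_iUnion fun j => leftEndpoints_finite (hZ j)
  obtain ⟨p, hp, hmem⟩ := exists_increasing_list hfin.toFinset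
  obtain ⟨j₀, -, hj₀⟩ := Set.mem_iUnion₂.1 (h.bot_subset rfl)
  have hlab : ∀ x, ∃ j, x ∈ (⊥ :: p : List I) → x ∈ leftEndpoints (Z j) := by
    intro x
    by_cases hx : x ∈ (⊥ :: p : List I)
    · rcases (hmem x).1 hx with rfl | hx
      · exact ⟨j₀, fun _ => hj₀⟩
      · obtain ⟨j, hj⟩ := Set.mem_iUnion.1 (hfin.mem_toFinset.1 hx)
        exact ⟨j, fun _ => hj⟩
    · exact ⟨j₀, fun h => absurd h hx⟩
  choose lab hlab using hlab
  have hleft : ∀ j, ∀ x ∈ leftEndpoints (Z j), x ∈ (⊥ :: p : List I) := fun j x hx =>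
    (hmem x).2 (Or.inr (hfin.mem_toFinset.2 (Set.mem_iUnion.2 ⟨j, hx⟩)))
  have hletter : ∀ x ∈ (⊥ :: p : List I), letter T x = (lab x).2.2 := by
    intro x hx
    ext t
    by_cases ht : t ∈ (lab x).2.2
    · simpa [ht] using h.left_subset _ t ht (hlab x hx)
    · simpa [ht] using fun hxt => h.left_inter _ t ht ⟨hlab x hx, hxt⟩
  refine ⟨p, hp, fun t x hx => ?_, ?_⟩
  · obtain ⟨j, -, hj⟩ := Set.mem_iUnion₂.1 (h.subset_left t hx)
    exact hleft j x hj
  · have hchain : (⊥ :: p).IsChain fun x y =>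
        (lab y).2.1 = M.step (lab x).2.1 (letter T x) := by
      rw [isChain_iff_consecutive hp]
      rintro x y ⟨hx, hy, hxy, hn⟩
      rw [hletter x hx]
      exact h.step_of_consecutive hZ (hlab x hx) (hlab y hy) hxy
        fun j z hz => hn z (hleft j z hz)
    have hbot : (lab ⊥).2.1 = M.start := by
      by_contra hne
      exact h.bot_start _ hne ⟨rfl, hlab ⊥ (by simp)⟩
    rw [DFA.mem_accepts, DFA.eval, ← hbot,
      evalFrom_of_isChain M (letter T) (fun x => (lab x).2.1) ⊥ p hchain,
      hletter _ (List.getLast_mem _)]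
    exact h.step_mem_accept hZ (hlab _ (List.getLast_mem _))
      fun j z hz => le_getLast_of_pairwise hp _ (hleft j z hz)

end CodesRun

/-- Density, avoiding the members of a finite set above `x`. -/
theorem exists_between_above [DenselyOrdered I] (S : Finset I) {x y : I} (hxy : x < y) :
    ∃ z, x < z ∧ z < y ∧ ∀ u ∈ S, x < u → z < u := by
  classical
  induction S using Finset.induction_on with
  | empty => simpa using exists_between hxy
  | insert a S _ ih =>
    obtain ⟨z, hxz, hzy, hz⟩ := ih
    by_cases ha : x < a
    · obtain ⟨z', h1, h2⟩ := exists_between (lt_min hxz ha)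
      refine ⟨z', h1, (h2.trans_le (min_le_left _ _)).trans hzy, fun u hu hxu => ?_⟩
      rcases Finset.mem_insert.1 hu with rfl | hu
      · exact h2.trans_le (min_le_right _ _)
      · exact (h2.trans_le (min_le_left _ _)).trans (hz u hu hxu)
    · refine ⟨z, hxz, hzy, fun u hu hxu => ?_⟩
      rcases Finset.mem_insert.1 hu with rfl | hu
      · exact absurd hxu ha
      · exact hz u hu hxu

theorem exists_between_below [DenselyOrdered I] (S : Finset I) {x y : I} (hxy : x < y) :
    ∃ z, x < z ∧ z < y ∧ ∀ u ∈ S, u < y → u < z := by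
  obtain ⟨z, h1, h2, h3⟩ := exists_between_above (I := Iᵒᵈ) S (x := y) (y := x) hxy
  exact ⟨z, h2, h1, h3⟩

section Decode

variable {L R : Finset I}

/-- If any two points of `L` are separated by a point of `R`, the intervals making up `decode L R`
do not merge. -/
theorem leftEndpoints_decode [DenselyOrdered I] (hd : Disjoint L R)
    (hs : ∀ x ∈ L, ∀ y ∈ L, x < y → ∃ z ∈ R, x < z ∧ z < y) :
    leftEndpoints (decode L R) = L := by
  ext x
  constructor
  · intro hx
    obtain ⟨⟨a, ha, hax, h⟩, -⟩ := mem_leftEndpoints_iff.1 hx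
    rcases hax.eq_or_lt with rfl | hax
    · exact ha
    · exact absurd hx (notMem_leftEndpoints_of_Icc_subset hax
        fun z hz => ⟨a, ha, hz.1, fun b hb hab => hz.2.trans (h b hb hab)⟩)
  · intro hx
    have hxR : x ∉ R := Finset.disjoint_left.1 hd hx
    refine mem_leftEndpoints_iff.2 ⟨⟨x, hx, le_rfl, fun _ _ h => h⟩, fun y hy => ?_⟩
    obtain ⟨z, hyz, hzx, hz⟩ := exists_between_below R hy
    refine ⟨z, hyz.le, hzx.le, ?_⟩
    rintro ⟨a, ha, haz, h⟩
    obtain ⟨b, hb, hab, hbx⟩ := hs a ha x hx (haz.trans_lt hzx)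
    exact (hz b hb hbx).not_ge (h b hb hab.le)

theorem mem_right_of_mem_rightEndpoints_decode [DenselyOrdered I] [NoMaxOrder I]
    (hd : Disjoint L R) {x : I} (hx : x ∈ rightEndpoints (decode L R)) :
    x ∈ R ∧ ∃ a ∈ L, a < x ∧ ∀ b ∈ R, a ≤ b → x ≤ b := by
  obtain ⟨⟨a, ha, hax, h⟩, -⟩ := mem_rightEndpoints_iff.1 hx
  have hxR : x ∈ R := by
    by_contra hxR
    obtain ⟨y, hy⟩ := exists_gt x
    obtain ⟨z, hxz, -, hz⟩ := exists_between_above R hy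
    refine notMem_rightEndpoints_of_Icc_subset hxz (fun u hu => ?_) hx
    refine ⟨a, ha, hax.trans hu.1, fun b hb hab => ?_⟩
    have hxb : x < b := lt_of_le_of_ne (h b hb hab) (by rintro rfl; exact hxR hb)
    exact hu.2.trans (hz b hb hxb).le
  exact ⟨hxR, a, ha, lt_of_le_of_ne hax (by rintro rfl; exact Finset.disjoint_left.1 hd ha hxR), h⟩

theorem mem_rightEndpoints_decode [DenselyOrdered I] {x : I} (hx : x ∈ decode L R) (hxR : x ∈ R) :
    x ∈ rightEndpoints (decode L R) := by
  refine mem_rightEndpoints_iff.2 ⟨hx, fun y hy => ?_⟩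
  obtain ⟨z, hxz, hzy, hz⟩ := exists_between_above L hy
  refine ⟨z, hxz.le, hzy.le, ?_⟩
  rintro ⟨a, ha, haz, h⟩
  have hax : a ≤ x := by
    by_contra! hxa
    exact (hz a ha hxa).not_ge haz
  exact hxz.not_ge (h x hxR hax)

/-- A nonempty `decode L R` without a maximum extends from the last point of `L` to infinity, beyond
all of `R`. -/
theorem decode_eq_empty_or_maxSet_nonempty_or (hd : Disjoint L R) :
    decode L R = ∅ ∨ (maxSet (decode L R)).Nonempty ∨ ∃ m ∈ L, ∀ b ∈ R, b ≤ m := by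
  rcases L.eq_empty_or_nonempty with rfl | hL
  · exact Or.inl (by ext; simp [decode])
  right
  obtain ⟨m, hm, hmax⟩ := L.exists_max_image id hL
  by_cases hR : ∀ b ∈ R, b ≤ m
  · exact Or.inr ⟨m, hm, hR⟩
  push Not at hR
  obtain ⟨b, hb, hmb⟩ := hR
  obtain ⟨y, hy, hmin⟩ := (R.filter (m < ·)).exists_min_image id
    ⟨b, Finset.mem_filter.2 ⟨hb, hmb⟩⟩
  obtain ⟨hyR, hmy⟩ := Finset.mem_filter.1 hy
  refine Or.inl ⟨y, ⟨m, hm, hmy.le, fun b hb hmb => hmin b (Finset.mem_filter.2 ⟨hb, ?_⟩)⟩, ?_⟩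
  · exact lt_of_le_of_ne hmb (by rintro rfl; exact Finset.disjoint_left.1 hd hm hb)
  · rintro z ⟨a, ha, haz, h⟩
    exact h y hyR ((hmax a ha).trans hmy.le)

end Decode

/-- An accepting run is coded by the sets `decode (Lf j) (Rt j)`, where `Lf j` consists of the points
labelled `j` and `Rt j` of the remaining points of the list: each component starts at a point
labelled `j` and is cut off at the next point, which has another parity and so lies in `Rt j`. -/
theorem exists_codesRun [OrderBot I] [DenselyOrdered I] [NoMaxOrder I] {M : DFA (Set V) σ}
    {T : V → Finset I} {p : List I} (hp : (⊥ :: p).Pairwise (· < ·))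
    (hT : ∀ t, ∀ x ∈ T t, x ∈ (⊥ :: p : List I)) (hacc : (⊥ :: p).map (letter T) ∈ M.accepts) :
    ∃ Z : Bool × σ × Set V → FCI I, CodesRun M (fun t => (T t : Set I)) fun j => (Z j).1 := by
  classical
  obtain ⟨s, hs, hchain⟩ := exists_states (fun q x => M.step q (letter T x)) ⊥ p hp M.start
  obtain ⟨b, -, hb⟩ := exists_states (fun q _ => !q) ⊥ p hp false
  rw [DFA.mem_accepts, DFA.eval, ← hs, evalFrom_of_isChain M (letter T) s ⊥ p hchain] at hacc
  rw [isChain_iff_consecutive hp] at hchain hb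
  have hlast : ∀ x ∈ (⊥ :: p : List I), (∀ y ∈ (⊥ :: p : List I), y ≤ x) →
      M.step (s x) (letter T x) ∈ M.accept := by
    intro x hx hmax
    rwa [le_antisymm (le_getLast_of_pairwise hp (by simp) hx) (hmax _ (List.getLast_mem _))]
  have hbot : ⊥ ∈ (⊥ :: p : List I) := by simp
  clear hacc
  generalize (⊥ :: p : List I) = p at *
  let lab : I → Bool × σ × Set V := fun x => (b x, s x, letter T x)
  let Lf : Bool × σ × Set V → Finset I := fun j => p.toFinset.filter fun x => lab x = j
  let Rt : Bool × σ × Set V → Finset I := fun j => p.toFinset.filter fun x => lab x ≠ j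
  have hLf : ∀ {j x}, x ∈ Lf j ↔ x ∈ p ∧ lab x = j := by simp [Lf]
  have hRt : ∀ {j x}, x ∈ Rt j ↔ x ∈ p ∧ lab x ≠ j := by simp [Rt]
  have hd : ∀ j, Disjoint (Lf j) (Rt j) := fun j =>
    Finset.disjoint_left.2 fun x hx hx' => (hRt.1 hx').2 (hLf.1 hx).2
  have hnext : ∀ x ∈ p, ∀ y ∈ p, x < y → ∃ z ≤ y, Consecutive p x z := by
    intro x hx y hy hxy
    obtain ⟨z, hz, hmin⟩ := (p.toFinset.filter (x < ·)).exists_min_image id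
      ⟨y, by simp [hy, hxy]⟩
    simp only [Finset.mem_filter, List.mem_toFinset, id, and_imp] at hz hmin
    exact ⟨z, hmin y hy hxy, hx, hz.1, hz.2, hmin⟩
  -- The parity separates two points with the same label by a point with another label.
  have hsep : ∀ j, ∀ x ∈ Lf j, ∀ y ∈ Lf j, x < y → ∃ z ∈ Rt j, x < z ∧ z < y := by
    intro j x hx y hy hxy
    obtain ⟨hxp, rfl⟩ := hLf.1 hx
    obtain ⟨hyp, hyx⟩ := hLf.1 hy
    obtain ⟨z, hzy, hc⟩ := hnext x hxp y hyp hxy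
    have hzx : lab z ≠ lab x := by
      intro h
      have := hb x z hc
      rw [show b z = b x from congrArg Prod.fst h] at this
      simp at this
    exact ⟨z, hRt.2 ⟨hc.2.1, hzx⟩, hc.2.2.1, lt_of_le_of_ne hzy (by rintro rfl; exact hzx hyx)⟩
  have hleft : ∀ j, leftEndpoints (decode (Lf j) (Rt j)) = Lf j := fun j =>
    leftEndpoints_decode (hd j) (hsep j)
  refine ⟨fun j => decodeFCI (Lf j) (Rt j), ?_⟩
  constructor
  all_goals simp only [decodeFCI, hleft]
  · rintro j j' hne x ⟨hx, hx'⟩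
    exact hne ((hLf.1 hx).2.symm.trans (hLf.1 hx').2)
  · rintro j j' hne x ⟨hx, hx'⟩
    obtain ⟨hxp, rfl⟩ := hLf.1 hx'
    exact mem_rightEndpoints_decode hx (hRt.2 ⟨hxp, hne.symm⟩)
  · intro j x hx
    obtain ⟨hxR, a, ha, hax, h⟩ := mem_right_of_mem_rightEndpoints_decode (hd j) hx
    have hxp := (hRt.1 hxR).1
    obtain ⟨hap, haj⟩ := hLf.1 ha
    have hc : Consecutive p a x := by
      refine ⟨hap, hxp, hax, fun z hz haz => ?_⟩
      by_cases hzj : lab z = j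
      · obtain ⟨y, hy, hay, hyz⟩ := hsep j a ha z (hLf.2 ⟨hz, hzj⟩) haz
        exact (h y hy hay.le).trans hyz.le
      · exact h z (hRt.2 ⟨hz, hzj⟩) haz.le
    subst haj
    refine Set.mem_iUnion₂.2 ⟨lab x, ⟨?_, hchain a x hc⟩, hLf.2 ⟨hxp, rfl⟩⟩
    simp [lab, hb a x hc]
  · rintro j t ht x hx
    obtain ⟨-, rfl⟩ := hLf.1 hx
    exact ht
  · rintro j t ht x ⟨hx, hxt⟩
    obtain ⟨-, rfl⟩ := hLf.1 hx
    exact ht hxt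
  · intro t x hx
    exact Set.mem_iUnion₂.2 ⟨lab x, trivial, hLf.2 ⟨hT t x hx, rfl⟩⟩
  · rintro j hj x ⟨rfl, hx⟩
    obtain ⟨-, rfl⟩ := hLf.1 hx
    exact hj hs
  · rintro x rfl
    exact Set.mem_iUnion₂.2 ⟨lab ⊥, trivial, hLf.2 ⟨hbot, rfl⟩⟩
  · rintro j hj ⟨hne, hmax⟩
    rcases decode_eq_empty_or_maxSet_nonempty_or (hd j) with h | ⟨x, hx⟩ | ⟨m, hm, h⟩
    · exact hne h.subset
    · exact hmax hx
    · obtain ⟨hmp, rfl⟩ := hLf.1 hm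
      obtain ⟨y, hy, hmy, hyj⟩ : ∃ y ∈ p, m < y ∧ lab y = lab m := by
        by_contra! hc
        refine hj (hlast m hmp fun y hy => ?_)
        by_contra! hmy
        exact hmy.not_ge (h y (hRt.2 ⟨hy, hc y hy hmy⟩))
      obtain ⟨z, hz, hmz, -⟩ := hsep _ m hm y (hLf.2 ⟨hy, hyj⟩) hmy
      exact hmz.not_ge (h z hz)

end Codes

/-! ### Existential definability and model-completeness -/

section Definability

variable {I : Type u} [LinearOrder I] [OrderBot I] {α : Type}

/-- A set depending on a tuple of finite unions of closed intervals that is the value of a term. -/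
def IsTerm (F : (α → FCI I) → Set I) : Prop :=
  ∃ t : langL.Term α, ∀ v, (t.realize v).1 = F v

/-- A predicate on tuples of finite unions of closed intervals that is defined by a quantifier-free
formula. -/
def IsQFDefinable (C : (α → FCI I) → Prop) : Prop :=
  ∃ θ : langL.Formula α, θ.IsQF ∧ ∀ v, θ.Realize v ↔ C v

theorem isTerm_var (a : α) : IsTerm fun v : α → FCI I => (v a).1 := ⟨.var a, fun _ => rfl⟩

namespace IsTerm

variable {F G : (α → FCI I) → Set I}

theorem union (hF : IsTerm F) (hG : IsTerm G) : IsTerm fun v => F v ∪ G v := by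
  obtain ⟨s, hs⟩ := hF
  obtain ⟨t, ht⟩ := hG
  refine ⟨.func LFun.union ![s, t], fun v => ?_⟩
  beta_reduce
  rw [← hs, ← ht]
  rfl

theorem inter (hF : IsTerm F) (hG : IsTerm G) : IsTerm fun v => F v ∩ G v := by
  obtain ⟨s, hs⟩ := hF
  obtain ⟨t, ht⟩ := hG
  refine ⟨.func LFun.inter ![s, t], fun v => ?_⟩
  beta_reduce
  rw [← hs, ← ht]
  rfl

theorem empty : IsTerm fun _ : α → FCI I => (∅ : Set I) :=
  ⟨.func LFun.bot ![], fun _ => rfl⟩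

theorem bot : IsTerm fun _ : α → FCI I => ({⊥} : Set I) :=
  ⟨.func LFun.zero ![], fun _ => rfl⟩

theorem maxSet (hF : IsTerm F) : IsTerm fun v => maxSet (F v) := by
  obtain ⟨s, hs⟩ := hF
  refine ⟨.func LFun.max ![s], fun v => ?_⟩
  beta_reduce
  rw [← hs]
  rfl

theorem leftEndpoints (hF : IsTerm F) : IsTerm fun v => leftEndpoints (F v) := by
  obtain ⟨s, hs⟩ := hF
  refine ⟨.func LFun.left ![s], fun v => ?_⟩
  beta_reduce
  rw [← hs]
  rfl

theorem rightEndpoints (hF : IsTerm F) : IsTerm fun v => rightEndpoints (F v) := by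
  obtain ⟨s, hs⟩ := hF
  refine ⟨.func LFun.right ![s], fun v => ?_⟩
  beta_reduce
  rw [← hs]
  rfl

theorem biUnion {ι : Type*} {F : ι → (α → FCI I) → Set I} (hF : ∀ i, IsTerm (F i)) {S : Set ι}
    (hS : S.Finite) : IsTerm fun v => ⋃ i ∈ S, F i v := by
  induction S, hS using Set.Finite.induction_on with
  | empty => simpa using empty
  | insert _ _ ih => simpa only [Set.biUnion_insert] using (hF _).union ih

end IsTerm

namespace IsQFDefinable

variable {C D : (α → FCI I) → Prop}

theorem congr (hC : IsQFDefinable C) (h : ∀ v, D v ↔ C v) : IsQFDefinable D := by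
  rwa [show D = C from funext fun v => propext (h v)]

theorem not (hC : IsQFDefinable C) : IsQFDefinable fun v => ¬ C v := by
  obtain ⟨θ, hθ, h⟩ := hC
  exact ⟨θ.not, hθ.not, fun v => (FirstOrder.Language.Formula.realize_not).trans (not_congr (h v))⟩

theorem and (hC : IsQFDefinable C) (hD : IsQFDefinable D) :
    IsQFDefinable fun v => C v ∧ D v := by
  obtain ⟨θ, hθ, h⟩ := hC
  obtain ⟨η, hη, h'⟩ := hD
  exact ⟨θ ⊓ η, hθ.inf hη, fun v =>
    (FirstOrder.Language.Formula.realize_inf).trans (and_congr (h v) (h' v))⟩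

theorem subset {F G : (α → FCI I) → Set I} (hF : IsTerm F) (hG : IsTerm G) :
    IsQFDefinable fun v => F v ⊆ G v := by
  obtain ⟨s, hs⟩ := hF.union hG
  obtain ⟨t, ht⟩ := hG
  refine ⟨s.equal t, .of_isAtomic (.equal _ _), fun v => ?_⟩
  beta_reduce at hs ⊢
  rw [FirstOrder.Language.Formula.realize_equal, ← Set.union_eq_right, ← hs, ← ht]
  exact Subtype.ext_iff

theorem const (q : Prop) : IsQFDefinable fun _ : α → FCI I => q := by
  by_cases hq : q
  · exact ⟨⊤, .top, fun v => by simp [hq]⟩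
  · exact ⟨⊥, .falsum, fun v => by simp [hq]⟩

theorem imp (q : Prop) (hC : IsQFDefinable C) : IsQFDefinable fun v => q → C v := by
  by_cases hq : q
  · simpa [hq] using hC
  · simpa [hq] using const True

theorem forall_finite {ι : Type*} [Finite ι] {C : ι → (α → FCI I) → Prop}
    (hC : ∀ i, IsQFDefinable (C i)) : IsQFDefinable fun v => ∀ i, C i v := by
  have : ∀ S : Set ι, S.Finite → IsQFDefinable fun v => ∀ i ∈ S, C i v := by
    intro S hS
    induction S, hS using Set.Finite.induction_on with
    | empty => simpa using const True
    | insert _ _ ih => simpa only [Set.forall_mem_insert] using (hC _).and ih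
  simpa using this Set.univ Set.finite_univ

end IsQFDefinable

theorem isQFDefinable_codesRun {V σ : Type} [Finite V] [Finite σ] (M : DFA (Set V) σ)
    {T : V → (α → FCI I) → Set I} {Z : Bool × σ × Set V → (α → FCI I) → Set I}
    (hT : ∀ t, IsTerm (T t)) (hZ : ∀ j, IsTerm (Z j)) :
    IsQFDefinable fun v => CodesRun M (fun t => T t v) fun j => Z j v := by
  have hl := fun j => (hZ j).leftEndpoints
  have h1 := IsQFDefinable.forall_finite fun j => .forall_finite fun j' => .imp (j ≠ j') <|
    .subset ((hl j).inter (hl j')) .empty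
  have h2 := IsQFDefinable.forall_finite fun j => .forall_finite fun j' => .imp (j ≠ j') <|
    .subset ((hZ j).inter (hl j')) (hZ j).rightEndpoints
  have h3 := IsQFDefinable.forall_finite fun j => .subset (hZ j).rightEndpoints <|
    .biUnion hl (Set.toFinite
      {j' : Bool × σ × Set V | j'.1 ≠ j.1 ∧ j'.2.1 = M.step j.2.1 j.2.2})
  have h4 := IsQFDefinable.forall_finite fun j => .forall_finite fun t => .imp (t ∈ j.2.2) <|
    .subset (hl j) (hT t)
  have h5 := IsQFDefinable.forall_finite fun j => .forall_finite fun t => .imp (t ∉ j.2.2) <|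
    .subset ((hl j).inter (hT t)) .empty
  have h6 := IsQFDefinable.forall_finite fun t => .subset (hT t) <|
    .biUnion hl (Set.toFinite Set.univ)
  have h7 := IsQFDefinable.forall_finite fun j : Bool × σ × Set V => .imp (j.2.1 ≠ M.start) <|
    .subset (.inter .bot (hl j)) .empty
  have h8 := IsQFDefinable.subset .bot (.biUnion hl (Set.toFinite Set.univ))
  have h9 := IsQFDefinable.forall_finite fun j : Bool × σ × Set V =>
    .imp (M.step j.2.1 j.2.2 ∉ M.accept) <|
      .not <| .and (.not <| .subset (hZ j) .empty) (.subset (hZ j).maxSet .empty)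
  refine (h1.and <| h2.and <| h3.and <| h4.and <| h5.and <| h6.and <| h7.and <| h8.and h9).congr
    fun v => ⟨fun h => ?_, fun h => ?_⟩
  · exact ⟨h.1, h.2, h.3, h.4, h.5, h.6, h.7, h.8, h.9⟩
  · obtain ⟨h1, h2, h3, h4, h5, h6, h7, h8, h9⟩ := h
    exact ⟨h1, h2, h3, h4, h5, h6, h7, h8, h9⟩

end Definability

section Existential

variable {L : FirstOrder.Language.{u, v}} {α : Type w}

theorem IsExistential.exs {n : ℕ} {φ : L.BoundedFormula α n} (h : IsExistential φ) :
    IsExistential φ.exs := by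
  induction n with
  | zero => exact h
  | succ n ih => exact ih h.ex

theorem realize_embedding_of_isQF {M N : Type*} [L.Structure M] [L.Structure N] (f : M ↪[L] N)
    {n : ℕ} {φ : L.BoundedFormula α n} (h : φ.IsQF) (v : α → M) (xs : Fin n → M) :
    φ.Realize (f ∘ v) (f ∘ xs) ↔ φ.Realize v xs := by
  induction h with
  | falsum => rfl
  | of_isAtomic h =>
    cases h with
    | equal s t =>
      simp only [FirstOrder.Language.BoundedFormula.realize_bdEqual, ← Sum.comp_elim,
        FirstOrder.Language.HomClass.realize_term, f.injective.eq_iff]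
    | rel R ts =>
      simp only [FirstOrder.Language.BoundedFormula.realize_rel, ← Sum.comp_elim,
        FirstOrder.Language.HomClass.realize_term]
      exact f.map_rel R _
  | imp _ _ ih ih' => simp only [FirstOrder.Language.BoundedFormula.realize_imp, ih, ih']

theorem IsExistential.realize_embedding {M N : Type*} [L.Structure M] [L.Structure N]
    (f : M ↪[L] N) {n : ℕ} {φ : L.BoundedFormula α n} (h : IsExistential φ) (v : α → M)
    (xs : Fin n → M) (hφ : φ.Realize v xs) : φ.Realize (f ∘ v) (f ∘ xs) := by
  induction h with
  | of_isQF h => exact (realize_embedding_of_isQF f h v xs).2 hφ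
  | ex _ ih =>
    rw [FirstOrder.Language.BoundedFormula.realize_ex] at hφ ⊢
    obtain ⟨a, ha⟩ := hφ
    refine ⟨f a, ?_⟩
    rw [← Fin.comp_snoc]
    exact ih _ ha

theorem realize_iff_of_completeTheory {L : FirstOrder.Language.{u, v}} {S : Type*} [L.Structure S]
    {n : ℕ} {φ ψ : L.Formula (Fin n)} (h : ∀ X : Fin n → S, φ.Realize X ↔ ψ.Realize X)
    {M : Type w} [L.Structure M] (hM : M ⊨ L.completeTheory S) (x : Fin n → M) :
    φ.Realize x ↔ ψ.Realize x := by
  let χ : L.Sentence := ((φ.iff ψ).relabel Sum.inr : L.Formula (Empty ⊕ Fin n)).iAlls (Fin n)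
  have hχ : χ ∈ L.completeTheory S := by
    rw [FirstOrder.Language.mem_completeTheory]
    refine FirstOrder.Language.Formula.realize_iAlls.2 fun X => ?_
    rw [FirstOrder.Language.Formula.realize_relabel, FirstOrder.Language.Formula.realize_iff]
    exact h _
  have := FirstOrder.Language.Formula.realize_iAlls.1
    (FirstOrder.Language.Theory.realize_sentence_of_mem (M := M) _ hχ) x
  rw [FirstOrder.Language.Formula.realize_relabel, FirstOrder.Language.Formula.realize_iff] at this
  exact this

/-- A complete theory of a structure in which every formula is equivalent to an existential one
is model-complete: embeddings preserve existential formulas, so both a formula and its negation. -/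
theorem isModelComplete_completeTheory {L : FirstOrder.Language.{0, 0}} (S : Type u) [L.Structure S]
    (H : ∀ (n : ℕ) (φ : L.Formula (Fin n)), ∃ ψ : L.Formula (Fin n), IsExistential ψ ∧
      ∀ X : Fin n → S, φ.Realize X ↔ ψ.Realize X) :
    IsModelComplete.{0, 0, w, w'} (L.completeTheory S) := by
  intro M N _ _ hM hN f n φ x
  -- Applied to a formula and to its negation, this gives both directions.
  have up : ∀ φ : L.Formula (Fin n), φ.Realize x → φ.Realize (f ∘ x) := by
    intro φ hφ
    obtain ⟨ψ, hψ, h⟩ := H n φ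
    rw [realize_iff_of_completeTheory h hN]
    rw [realize_iff_of_completeTheory h hM] at hφ
    have := hψ.realize_embedding f x default hφ
    rwa [Subsingleton.elim (f ∘ default) default] at this
  refine ⟨fun h => ?_, up φ⟩
  by_contra hc
  exact up φ.not hc h

end Existential

theorem exists_existential_formula (I : Type u) [LinearOrder I] [OrderBot I] [DenselyOrdered I]
    [NoMaxOrder I] (n : ℕ) (φ : langL.Formula (Fin n)) :
    ∃ ψ : langL.Formula (Fin n), IsExistential ψ ∧
      ∀ X : Fin n → FCI I, φ.Realize X ↔ ψ.Realize X := by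
  have hrec : Recognizable fun Z : Fin n × Bool → Finset I => φ.Realize (decodeTuple Z) := by
    refine ((recognizable_formula φ).reindex (W := Fin n × Bool)
      fun q => (q.1.elim id Fin.elim0, q.2)).congr fun Z => ?_
    exact iff_of_eq (congrArg (FirstOrder.Language.BoundedFormula.Realize φ (decodeTuple Z))
      (Subsingleton.elim _ _))
  obtain ⟨L, hL, H⟩ := hrec
  obtain ⟨σ, _, M, rfl⟩ := hL
  have hT : ∀ t : Fin n × Bool,
      IsTerm fun v : Fin n ⊕ (Bool × σ × Set (Fin n × Bool)) → FCI I =>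
        (endpoints (v (Sum.inl t.1)) t.2 : Set I) := by
    rintro ⟨i, _ | _⟩
    · simpa [endpoints] using (isTerm_var _).leftEndpoints
    · simpa [endpoints] using (isTerm_var _).rightEndpoints
  obtain ⟨θ, hθ, h⟩ := isQFDefinable_codesRun M hT fun j => isTerm_var (Sum.inr j)
  refine ⟨θ.iExs _, (IsExistential.of_isQF (hθ.relabel _)).exs, fun X => ?_⟩
  rw [FirstOrder.Language.Formula.realize_iExs]
  simp only [h, Sum.elim_inl, Sum.elim_inr]
  let T : Fin n × Bool → Finset I := fun t => endpoints (X t.1) t.2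
  have hX : decodeTuple T = X := funext fun i => decodeFCI_endpoints (X i)
  have key := H T
  beta_reduce at key
  rw [hX] at key
  constructor
  · intro hφ
    obtain ⟨p, hp, hmem⟩ := exists_increasing_list (Finset.univ.biUnion T)
    have hTp : ∀ t, ∀ x ∈ T t, x ∈ (⊥ :: p : List I) := fun t x hx =>
      (hmem x).2 (Or.inr (Finset.mem_biUnion.2 ⟨t, Finset.mem_univ _, hx⟩))
    exact exists_codesRun hp hTp ((key p hp hTp).1 hφ)
  · rintro ⟨Z, hZ⟩
    obtain ⟨p, hp, hTp, hacc⟩ := CodesRun.exists_accepted (T := T) hZ fun j => (Z j).2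
    exact (key p hp hTp).2 hacc

end ClosedIntervals

theorem mainTheorem1 (I : Type u) [LinearOrder I] [OrderBot I] [DenselyOrdered I] [NoMaxOrder I] :
    ClosedIntervals.IsModelComplete.{0, 0, w, w'}
        (ClosedIntervals.langL.completeTheory (ClosedIntervals.FCI I)) ∧
      ∀ (n : ℕ) (φ : ClosedIntervals.langL.Formula (Fin n)),
        ∃ ψ : ClosedIntervals.langL.Formula (Fin n), ClosedIntervals.IsExistential ψ ∧
          ∀ X : Fin n → ClosedIntervals.FCI I, φ.Realize X ↔ ψ.Realize X := by
  have h := ClosedIntervals.exists_existential_formula I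
  exact ⟨ClosedIntervals.isModelComplete_completeTheory _ h, h⟩
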